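/- Let $(\Omega,\mathcal E,\mathbb P)$ be a probability space, $\mathcal F\subseteq\mathcal E$ a sub-$\sigma$-algebra, and let $L^0(\mathcal E)$, $L^0(\mathcal F)$ be the rings of (classes modulo a.s. equality of) real-valued $\mathcal E$-, respectively $\mathcal F$-measurable random variables, with the a.s. order. Let $\varphi:[0,\infty)\to[0,\infty]$ be a Young function, i.e. nondecreasing, left-continuous, convex, finite in a neighbourhood of $0$, with $\varphi(0)=0$ and $\lim_{t\to\infty}\varphi(t)=\infty$, and let $\varphi^*(s)=\sup_{t\ge0}(ts-\varphi(t))$. For $\psi\in\{\varphi,\varphi^*\}$ put $$L^\psi_{\mathcal F}(\mathcal E)=\{x\in L^0(\mathcal E):\ \mathbb E[\psi(|x|\lambda^{-1})\,|\,\mathcal F]<\infty\text{ a.s. for some }\lambda\in L^0(\mathcal F),\ \lambda>0\text{ a.s.}\},$$ and $L^1_{\mathcal F}(\mathcal E)=\{x\in L^0(\mathcal E):\mathbb E[|x|\,|\,\mathcal F]<\infty\text{ a.s.}\}$. For $x\in L^1_{\mathcal F}(\mathcal E)$ one can write $x=\sum_k 1_{A_k}x_k$ with a countable partition $(A_k)$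 of $\Omega$ into sets of $\mathcal F$ and integrable $x_k$, and $\mathbb E[x|\mathcal F]:=\sum_k1_{A_k}\mathbb E[x_k|\mathcal F]$, which does not depend on the choice. A concatenation of $(x_k)$ along such a partition $(A_k)$ is the element $x$ with $1_{A_k}x=1_{A_k}x_k$ for all $k$; the countable concatenation hull of a set is the set of all concatenations of its elements, the set has the countable concatenation property if it equals its hull, and a function is stable if it preserves concatenations. The conditional set generated by a set $S$ is the collection of all $x|A$, $x\in S$, $A\in\mathcal F$, where $x|A=y|B$ iff $A=B$ a.s. and $1_Ax=1_By$ (for functions with values in $L^0(\mathcal F)$ all this is meant pointwise); $[x\,;\,x\in S]$ denotes the conditional set generated by the hull of $S$. A conditionally linear functional on $\mathbf L^\varphi$ is a stable $L^0(\mathcal F)$-linear map $\mu:L^\varphi_{\mathcal F}(\mathcal E)\to L^0(\mathcal F)$. It is conditionally order continuous if * (order boundedness) for every $x\in L^\varphi_{\mathcal F}(\mathcal E)$ there is $0\le y\in L^0(\mathcal F)$ such that $-y\le\mu(z)\le y$ for all $z\in L^\varphi_{\mathcal F}(\mathcal E)$ with $-|x|\le z\le|x|$, and * for every non-empty downward directed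 set $D\subseteq L^\varphi_{\mathcal F}(\mathcal E)$ with the countable concatenation property and $\operatorname{ess\,inf}D=0$ one has $\operatorname{ess\,inf}_{x\in D}|\mu(x)|=0$. Let $[\mathbf L^\varphi]^\sim_n$ be the conditional set generated by the conditionally order continuous, conditionally linear functionals on $\mathbf L^\varphi$. Then: 1. $xy\in L^1_{\mathcal F}(\mathcal E)$ for all $x\in L^\varphi_{\mathcal F}(\mathcal E)$ and $y\in L^{\varphi^*}_{\mathcal F}(\mathcal E)$, so that $\mu_y(x):=\mathbb E[xy|\mathcal F]$ defines a map $\mu_y:L^\varphi_{\mathcal F}(\mathcal E)\to L^0(\mathcal F)$. 2. The conditionally order continuous, conditionally linear functionals on $\mathbf L^\varphi$ are exactly the maps $\mu_y$ with $y\in L^{\varphi^*}_{\mathcal F}(\mathcal E)$. 3. As conditional sets, $[\mathbf L^\varphi]^\sim_n=[\boldsymbol\mu_{\mathbf y}\,;\,\mathbf y\in\mathbf L^{\varphi^*}]$. 4. The map $y\mapsto\mu_y$ is injective on $L^{\varphi^*}_{\mathcal F}(\mathcal E)$; hence it identifies $L^{\varphi^*}_{\mathcal F}(\mathcal E)$ with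 the set of conditionally order continuous, conditionally linear functionals. -/

import Mathlib

open MeasureTheory Set Filter Topology
open scoped NNReal ENNReal

noncomputable section

namespace CondOrlicz

/-! Throughout, `mΩ` is the large σ-algebra of the probability space `(Ω, mΩ, P)`, and `F` is a
sub-σ-algebra. `L⁰(mΩ)` is Mathlib's space `Ω →ₘ[P] ℝ` of random variables modulo almost sure
equality, with the almost sure order. -/

instance instCommRingL0 {Ω : Type*} [MeasurableSpace Ω] {P : Measure Ω} :
    CommRing (Ω →ₘ[P] ℝ) :=
  { (inferInstance : AddCommGroup (Ω →ₘ[P] ℝ)), (inferInstance : CommMonoid (Ω →ₘ[P] ℝ)) with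
    left_distrib := by
      intro a b c
      induction a, b, c using AEEqFun.induction_on₃ with
      | _ f hf g hg h hh => simp [AEEqFun.mk_add_mk, AEEqFun.mk_mul_mk, mul_add]
    right_distrib := by
      intro a b c
      induction a, b, c using AEEqFun.induction_on₃ with
      | _ f hf g hg h hh => simp [AEEqFun.mk_add_mk, AEEqFun.mk_mul_mk, add_mul]
    zero_mul := by
      intro a
      induction a using AEEqFun.induction_on with
      | _ f hf => rw [AEEqFun.zero_def, AEEqFun.mk_mul_mk]; congr 1; ext; simp
    mul_zero := by
      intro a
      induction a using AEEqFun.induction_on with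
      | _ f hf => rw [AEEqFun.zero_def, AEEqFun.mk_mul_mk]; congr 1; ext; simp }

variable {Ω : Type*} (F : MeasurableSpace Ω) [mΩ : MeasurableSpace Ω] (P : Measure Ω)

/-- `L⁰(F)`: the classes in `L⁰(mΩ)` that have an `F`-measurable representative. -/
def L0F : Subring (Ω →ₘ[P] ℝ) where
  carrier := {x | AEStronglyMeasurable[F] x P}
  mul_mem' {a b} ha hb := (AEStronglyMeasurable.mul ha hb).congr (AEEqFun.coeFn_mul a b).symm
  add_mem' {a b} ha hb := (AEStronglyMeasurable.add ha hb).congr (AEEqFun.coeFn_add a b).symm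
  one_mem' := (aestronglyMeasurable_const (b := (1 : ℝ))).congr AEEqFun.coeFn_one.symm
  zero_mem' := (aestronglyMeasurable_const (b := (0 : ℝ))).congr AEEqFun.coeFn_zero.symm
  neg_mem' {a} ha := (AEStronglyMeasurable.neg ha).congr (AEEqFun.coeFn_neg a).symm

/-! ### Concatenations and conditional sets -/

/-- The sets of the σ-algebra `F`. -/
abbrev FSet := {A : Set Ω // MeasurableSet[F] A}

/-- The countable partitions of `Ω` into sets of `F` (some of them may be empty). -/
def IsPartition (A : ℕ → FSet F) : Prop :=
  Pairwise (fun i j => Disjoint (A i).1 (A j).1) ∧ ⋃ k, (A k).1 = univ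

variable {F} in
/-- The class of the indicator function `1_A` in `L⁰(F)`. -/
def ind (hF : F ≤ mΩ) (A : FSet F) : L0F F P :=
  ⟨AEEqFun.mk (A.1.indicator fun _ => (1 : ℝ))
      ((aestronglyMeasurable_const).indicator (hF _ A.2)),
    (StronglyMeasurable.aestronglyMeasurable
      ((@stronglyMeasurable_const _ _ F _ (1 : ℝ)).indicator A.2)).congr
      (AEEqFun.coeFn_mk _ _).symm⟩

section Module

variable {F} (hF : F ≤ mΩ) {V W : Type*} [AddCommGroup V] [Module (L0F F P) V]
  [AddCommGroup W] [Module (L0F F P) W]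

/-- `x` is a concatenation `∑ 1_{A_k} x_k` of `(x_k)` along the partition `(A_k)`. -/
def IsConcat (A : ℕ → FSet F) (xs : ℕ → V) (x : V) : Prop :=
  ∀ k, ind P hF (A k) • x = ind P hF (A k) • xs k

/-- The countable concatenation hull of `S`. -/
def ccHull (S : Set V) : Set V :=
  {x | ∃ A : ℕ → FSet F, IsPartition F A ∧ ∃ xs : ℕ → V, (∀ k, xs k ∈ S) ∧ IsConcat P hF A xs x}

/-- The countable concatenation property. -/
def HasCCP (S : Set V) : Prop := ccHull P hF S = S

/-- Stable functions: those preserving countable concatenations. -/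
def IsStable (f : V → W) : Prop :=
  ∀ A : ℕ → FSet F, IsPartition F A → ∀ (xs : ℕ → V) (x : V),
    IsConcat P hF A xs x → IsConcat P hF A (fun k => f (xs k)) (f x)

/-- The relation on `V × F` whose classes are the `x|A`: `x|A = y|B` if and only if `A = B`
almost surely and `1_A x = 1_B y`. -/
def condSetoid (V : Type*) [AddCommGroup V] [Module (L0F F P) V] : Setoid (V × FSet F) where
  r p q := p.2.1 =ᵐ[P] q.2.1 ∧ ind P hF p.2 • p.1 = ind P hF q.2 • q.1
  iseqv := ⟨fun _ => ⟨ae_eq_refl _, rfl⟩, fun h => ⟨h.1.symm, h.2.symm⟩,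
    fun h h' => ⟨h.1.trans h'.1, h.2.trans h'.2⟩⟩

/-- The conditional set generated by `S`: the collection of all `x|A` with `x ∈ S`, `A ∈ F`. -/
def condSet (S : Set V) : Set (Quotient (condSetoid P hF V)) :=
  {q | ∃ x ∈ S, ∃ A : FSet F, q = Quotient.mk (condSetoid P hF V) (x, A)}

/-- The set-builder notation `[x ; x ∈ S]`: the conditional set generated by the countable
concatenation hull of `S`. -/
def condBuilder (S : Set V) : Set (Quotient (condSetoid P hF V)) := condSet P hF (ccHull P hF S)

end Module

/-! ### Conditional expectation -/

/-- The module `L¹_F(mΩ)` of all `x` with `E[|x| | F] < ∞` almost surely. -/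
def L1F : Set (Ω →ₘ[P] ℝ) :=
  {x | ∀ᵐ ω ∂P, condLExp F P (fun ω' => ‖x ω'‖ₑ) ω < ∞}

/-- `z = E[x | F]` in the extended sense: `x = ∑ 1_{A_k} x_k` with integrable `x_k` and
`z = ∑ 1_{A_k} E[x_k | F]`. -/
def IsCondExp (x : Ω →ₘ[P] ℝ) (z : L0F F P) : Prop :=
  ∃ A : ℕ → FSet F, IsPartition F A ∧ ∃ xs : ℕ → Ω →ₘ[P] ℝ, ∀ k,
    Integrable (xs k) P ∧
    (∀ᵐ ω ∂P, ω ∈ (A k).1 → x ω = xs k ω) ∧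
    (∀ᵐ ω ∂P, ω ∈ (A k).1 → (z : Ω →ₘ[P] ℝ) ω = (P[xs k | F]) ω)

variable {F P} in
/-- The extended conditional expectation does not depend on the chosen decomposition. -/
theorem IsCondExp.unique [IsFiniteMeasure P] {x : Ω →ₘ[P] ℝ} {z z' : L0F F P}
    (h : IsCondExp F P x z) (h' : IsCondExp F P x z') : z = z' := by
  obtain ⟨A, hA, xs, hx⟩ := h
  obtain ⟨B, hB, ys, hy⟩ := h'
  have key : ∀ i j, ∀ᵐ ω ∂P, ω ∈ (A i).1 → ω ∈ (B j).1 →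
      (z : Ω →ₘ[P] ℝ) ω = (z' : Ω →ₘ[P] ℝ) ω := by
    intro i j
    have hm : MeasurableSet[F] ((A i).1 ∩ (B j).1) := (A i).2.inter (B j).2
    have e : ((A i).1 ∩ (B j).1).indicator (xs i) =ᵐ[P]
        ((A i).1 ∩ (B j).1).indicator (ys j) := by
      filter_upwards [(hx i).2.1, (hy j).2.1] with ω h1 h2
      by_cases hω : ω ∈ (A i).1 ∩ (B j).1
      · rw [indicator_of_mem hω, indicator_of_mem hω, ← h1 hω.1, ← h2 hω.2]
      · rw [indicator_of_notMem hω, indicator_of_notMem hω]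
    filter_upwards [(hx i).2.2, (hy j).2.2, condExp_congr_ae (m := F) e,
      condExp_indicator (hx i).1 hm, condExp_indicator (hy j).1 hm] with ω h1 h2 h3 h4 h5 ha hb
    rw [h1 ha, h2 hb]
    have hab : ω ∈ (A i).1 ∩ (B j).1 := ⟨ha, hb⟩
    rw [h4, h5, indicator_of_mem hab, indicator_of_mem hab] at h3
    exact h3
  apply Subtype.ext
  apply AEEqFun.ext
  filter_upwards [ae_all_iff.2 fun i => ae_all_iff.2 (key i)] with ω hω
  obtain ⟨i, hi⟩ := mem_iUnion.1 (hA.2 ▸ mem_univ ω : ω ∈ ⋃ k, (A k).1)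
  obtain ⟨j, hj⟩ := mem_iUnion.1 (hB.2 ▸ mem_univ ω : ω ∈ ⋃ k, (B k).1)
  exact hω i j hi hj

open Classical in
/-- The extended conditional expectation `E[x | F]`, for `x` in `L¹_F(mΩ)`; the value for other
`x` is irrelevant. -/
def condE (x : Ω →ₘ[P] ℝ) : L0F F P :=
  if h : ∃ z, IsCondExp F P x z then h.choose else 0

/-! ### Young functions and Orlicz-type modules -/

/-- Young functions `φ : [0,∞) → [0,∞]`. -/
structure IsYoung (φ : ℝ≥0 → ℝ≥0∞) : Prop where
  mono : Monotone φ
  leftContinuous : ∀ t, ContinuousWithinAt φ (Iic t) t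
  convex : ConvexOn ℝ≥0 univ φ
  finite_near_zero : ∀ᶠ t in 𝓝 0, φ t < ∞
  map_zero : φ 0 = 0
  tendsto_top : Tendsto φ atTop (𝓝 ∞)

/-- The conjugate `φ*(s) = sup_{t ≥ 0} (t s - φ(t))`. The subtraction is truncated at `0`, which
does not change the supremum, as `t = 0` contributes `0` for a Young function. -/
def conj (φ : ℝ≥0 → ℝ≥0∞) (s : ℝ≥0) : ℝ≥0∞ := ⨆ t : ℝ≥0, ((t * s : ℝ≥0) : ℝ≥0∞) - φ t

/-- The set `L^φ_F(mΩ)` of all `x` such that `E[φ(|x| λ⁻¹) | F] < ∞` almost surely for some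
`λ ∈ L⁰(F)` with `λ > 0` almost surely. -/
def orliczSet (φ : ℝ≥0 → ℝ≥0∞) : Set (Ω →ₘ[P] ℝ) :=
  {x | ∃ l : L0F F P, (∀ᵐ ω ∂P, 0 < (l : Ω →ₘ[P] ℝ) ω) ∧
    ∀ᵐ ω ∂P, condLExp F P (fun ω' => φ (‖x ω'‖₊ * ‖(l : Ω →ₘ[P] ℝ) ω'‖₊⁻¹)) ω < ∞}

variable {φ : ℝ≥0 → ℝ≥0∞}

/-- The Orlicz-type module `L^φ_F(mΩ)`, as an `L⁰(F)`-submodule of `L⁰(mΩ)`. -/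
def orlicz (hφ : IsYoung φ) : Submodule (L0F F P) (Ω →ₘ[P] ℝ) where
  carrier := orliczSet F P φ
  zero_mem' := by
    refine ⟨1, ?_, ?_⟩
    · filter_upwards [AEEqFun.coeFn_one (μ := P) (α := Ω) (β := ℝ)] with ω h
      rw [OneMemClass.coe_one, h]; simp
    · have : (fun ω' => φ (‖(0 : Ω →ₘ[P] ℝ) ω'‖₊ *
          ‖((1 : L0F F P) : Ω →ₘ[P] ℝ) ω'‖₊⁻¹)) =ᵐ[P] 0 := by
        filter_upwards [AEEqFun.coeFn_zero (μ := P) (α := Ω) (β := ℝ)] with ω h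
        rw [h]; simp [hφ.map_zero]
      filter_upwards [condLExp_congr_ae (mΩ := F) this] with ω h
      rw [h, condLExp_zero]; simp
  add_mem' := by
    rintro x y ⟨l, hl, hx⟩ ⟨k, hk, hy⟩
    have e1 := AEEqFun.coeFn_add (l : Ω →ₘ[P] ℝ) k
    have e2 := AEEqFun.coeFn_add ((l : Ω →ₘ[P] ℝ) + (k : Ω →ₘ[P] ℝ))
      ((l : Ω →ₘ[P] ℝ) + (k : Ω →ₘ[P] ℝ))
    refine ⟨(l + k) + (l + k), ?_, ?_⟩
    · filter_upwards [hl, hk, e1, e2] with ω h1 h2 h3 h4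
      simp only [Subring.coe_add, h4, h3, Pi.add_apply]
      positivity
    · have hmeas : AEMeasurable (fun ω => φ (‖x ω‖₊ * ‖(l : Ω →ₘ[P] ℝ) ω‖₊⁻¹)) P :=
        (hφ.mono.measurable.comp (x.measurable.nnnorm.mul
          (l : Ω →ₘ[P] ℝ).measurable.nnnorm.inv)).aemeasurable
      have hle : (fun ω => φ (‖(x + y) ω‖₊ * ‖(((l + k) + (l + k) : L0F F P) :
          Ω →ₘ[P] ℝ) ω‖₊⁻¹)) ≤ᵐ[P] (fun ω => φ (‖x ω‖₊ * ‖(l : Ω →ₘ[P] ℝ) ω‖₊⁻¹)) +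
            fun ω => φ (‖y ω‖₊ * ‖(k : Ω →ₘ[P] ℝ) ω‖₊⁻¹) := by
        filter_upwards [hl, hk, e1, e2, AEEqFun.coeFn_add x y] with ω h1 h2 h3 h4 h5
        simp only [Subring.coe_add, h5, h4, h3, Pi.add_apply]
        have hmax : ‖x ω + y ω‖₊ * ‖(l : Ω →ₘ[P] ℝ) ω + (k : Ω →ₘ[P] ℝ) ω +
            ((l : Ω →ₘ[P] ℝ) ω + (k : Ω →ₘ[P] ℝ) ω)‖₊⁻¹ ≤
            max (‖x ω‖₊ * ‖(l : Ω →ₘ[P] ℝ) ω‖₊⁻¹) (‖y ω‖₊ * ‖(k : Ω →ₘ[P] ℝ) ω‖₊⁻¹) := by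
          generalize (l : Ω →ₘ[P] ℝ) ω = p at *
          generalize (k : Ω →ₘ[P] ℝ) ω = q at *
          rw [← NNReal.coe_le_coe, NNReal.coe_max]
          push_cast
          rw [Real.norm_of_nonneg h1.le, Real.norm_of_nonneg h2.le,
            Real.norm_of_nonneg (by positivity : 0 ≤ p + q + (p + q))]
          set M := max (‖x ω‖ * p⁻¹) (‖y ω‖ * q⁻¹)
          have hM1 : ‖x ω‖ ≤ M * p := by
            rw [← div_le_iff₀ h1, div_eq_mul_inv]; exact le_max_left _ _
          have hM2 : ‖y ω‖ ≤ M * q := by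
            rw [← div_le_iff₀ h2, div_eq_mul_inv]; exact le_max_right _ _
          have hM0 : 0 ≤ M := le_trans (by positivity) (le_max_left _ _)
          rw [← div_eq_mul_inv, div_le_iff₀ (by positivity)]
          nlinarith [norm_add_le (x ω) (y ω), mul_nonneg hM0 h1.le, mul_nonneg hM0 h2.le]
        refine (hφ.mono hmax).trans ?_
        rcases max_cases (‖x ω‖₊ * ‖(l : Ω →ₘ[P] ℝ) ω‖₊⁻¹)
          (‖y ω‖₊ * ‖(k : Ω →ₘ[P] ℝ) ω‖₊⁻¹) with h | h
        · rw [h.1]; exact le_self_add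
        · rw [h.1]; exact le_add_self
      filter_upwards [condLExp_mono (mΩ := F) hle, condLExp_add_left (mΩ := F) _ hmeas, hx, hy]
        with ω h1 h2 h3 h4
      exact h1.trans_lt (h2 ▸ ENNReal.add_lt_top.2 ⟨h3, h4⟩)
  smul_mem' := by
    rintro a x ⟨l, hl, hx⟩
    have e1 := AEEqFun.coeFn_mul (l : Ω →ₘ[P] ℝ) (1 + (a : Ω →ₘ[P] ℝ) * a)
    have e2 := AEEqFun.coeFn_add (1 : Ω →ₘ[P] ℝ) ((a : Ω →ₘ[P] ℝ) * a)
    have e3 := AEEqFun.coeFn_mul (a : Ω →ₘ[P] ℝ) a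
    have e4 := AEEqFun.coeFn_one (μ := P) (α := Ω) (β := ℝ)
    refine ⟨l * (1 + a * a), ?_, ?_⟩
    · filter_upwards [hl, e1, e2, e3, e4] with ω h0 h1 h2 h3 h4
      simp only [Subring.coe_mul, Subring.coe_add, Subring.coe_one, h1, h2, h3, h4,
        Pi.add_apply, Pi.mul_apply, Pi.one_apply]
      nlinarith [mul_self_nonneg ((a : Ω →ₘ[P] ℝ) ω)]
    · have hle : (fun ω => φ (‖(a • x) ω‖₊ * ‖((l * (1 + a * a) : L0F F P) :
          Ω →ₘ[P] ℝ) ω‖₊⁻¹)) ≤ᵐ[P] fun ω => φ (‖x ω‖₊ * ‖(l : Ω →ₘ[P] ℝ) ω‖₊⁻¹) := by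
        filter_upwards [hl, e1, e2, e3, e4, AEEqFun.coeFn_mul (a : Ω →ₘ[P] ℝ) x]
          with ω h0 h1 h2 h3 h4 h5
        simp only [Subring.smul_def, smul_eq_mul, Subring.coe_mul, Subring.coe_add,
          Subring.coe_one, h1, h2, h3, h4, h5, Pi.add_apply, Pi.mul_apply, Pi.one_apply]
        apply hφ.mono
        generalize (l : Ω →ₘ[P] ℝ) ω = p at *
        generalize (a : Ω →ₘ[P] ℝ) ω = q at *
        rw [← NNReal.coe_le_coe]
        push_cast
        have hq : (0 : ℝ) < 1 + q * q := by nlinarith [mul_self_nonneg q]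
        rw [norm_mul, norm_mul, Real.norm_of_nonneg h0.le, Real.norm_of_nonneg hq.le,
          ← div_eq_mul_inv, ← div_eq_mul_inv, div_le_div_iff₀ (by positivity) h0]
        have hq' : ‖q‖ ≤ 1 + q * q := by
          rw [Real.norm_eq_abs]; nlinarith [sq_abs q, sq_nonneg (|q| - 1)]
        have := mul_le_mul_of_nonneg_right hq' (mul_nonneg (norm_nonneg (x ω)) h0.le)
        linarith
      filter_upwards [condLExp_mono (mΩ := F) hle, hx] with ω h1 h2
      exact h1.trans_lt h2

/-! ### Conditionally linear functionals and order continuity -/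

section Functionals

variable {F P} (hF : F ≤ mΩ) (hφ : IsYoung φ)

/-- Conditionally linear functions `L^φ → R`: stable homomorphisms of `L⁰(F)`-modules. -/
def IsCondLinear (f : orlicz F P hφ → L0F F P) : Prop :=
  IsStable P hF f ∧ IsLinearMap (L0F F P) f

/-- Conditional order boundedness: `f([-|x|, |x|]) ⊆ [-y, y]` for some `y ∈ L⁰₊(F)`. -/
def IsOrderBounded (f : orlicz F P hφ → L0F F P) : Prop :=
  ∀ x : orlicz F P hφ, ∃ y : L0F F P, (0 : Ω →ₘ[P] ℝ) ≤ y ∧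
    ∀ z : orlicz F P hφ, (z : Ω →ₘ[P] ℝ) ∈ Icc (-|(x : Ω →ₘ[P] ℝ)|) |(x : Ω →ₘ[P] ℝ)| →
      (f z : Ω →ₘ[P] ℝ) ∈ Icc (-(y : Ω →ₘ[P] ℝ)) y

/-- Conditional order continuity: order boundedness, and `inf_{x ∈ D} |f(x)| = 0` for every
conditionally downward directed conditional subset of `L^φ` (generated by a non-empty downward
directed set `D` with the countable concatenation property) with `inf D = 0`. -/
def IsCondOrderContinuous (f : orlicz F P hφ → L0F F P) : Prop :=
  IsOrderBounded hφ f ∧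
    ∀ D : Set (orlicz F P hφ), D.Nonempty → HasCCP P hF D →
      DirectedOn (fun x y : orlicz F P hφ => (y : Ω →ₘ[P] ℝ) ≤ x) D →
      IsGLB ((fun x : orlicz F P hφ => (x : Ω →ₘ[P] ℝ)) '' D) 0 →
      IsGLB ((fun x : orlicz F P hφ => |(f x : Ω →ₘ[P] ℝ)|) '' D) 0

/-- The set of conditionally order continuous, conditionally linear functions `L^φ → R`. -/
def orderDual : Set (orlicz F P hφ → L0F F P) :=
  {f | IsCondLinear hF hφ f ∧ IsCondOrderContinuous hF hφ f}

variable (F P) in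
/-- The function `μ_y : x ↦ E[x y | F]` on `L^φ_F(mΩ)`. -/
def muFun (y : Ω →ₘ[P] ℝ) : orlicz F P hφ → L0F F P :=
  fun x => condE F P ((x : Ω →ₘ[P] ℝ) * y)

end Functionals

end CondOrlicz

end

/-!
An everywhere positive `F`-measurable function is called a weight. A nonnegative random variable has
almost surely finite conditional expectation if and only if some weight makes it integrable, so that
conditional statements reduce to unconditional ones.

Let `f` be conditionally linear and order continuous, and `0 ≤ x ∈ L^φ_F`. For a weight `w` with
`w |f(z)| ≤ 1` whenever `|z| ≤ x`, the set function `A ↦ E[w f(1_A x)]` is a charge. It is countably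
additive: if `A_n ↓ ∅`, the restrictions of `x` to `A_N` with an `F`-measurable index `N` form a
downward directed family with the countable concatenation property and infimum `0`. The
Radon–Nikodym theorem gives a density `g` with `f(1_A x) = E[1_A g | F]`. Let `y` be the density
for `x = 1`. By locality, a countably valued `s` has density `s y`, and approximation by such `s`
yields `f = μ_y`.

That `y ∈ L^{φ*}_F` is a converse Hölder inequality. Suppose that `E[φ*(4^{-k} |y|) | F] = ∞` for
all `k` on a set of positive measure. Approximate maximisers of `t ↦ 4^{-k} |y| t - φ(t)`, rescaled
so that `E[φ(x_k) | F] ≤ 1`, satisfy `E[x_k |y| | F] ≥ 4^k` there. The supremum `x` of the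
`2^{-k-1} x_k` lies in `L^φ_F`, by convexity, while `E[x |y| | F] = ∞`, a contradiction.
-/

noncomputable section

namespace CondOrlicz

variable {Ω : Type*} {F : MeasurableSpace Ω}

/-- Weights are the everywhere positive `F`-measurable functions. Multiplying by a weight turns
almost sure finiteness of a conditional expectation into integrability. -/
structure IsWeight (F : MeasurableSpace Ω) (w : Ω → ℝ≥0) : Prop where
  meas : Measurable[F] w
  pos : ∀ ω, 0 < w ω

namespace IsWeight

variable {w v : Ω → ℝ≥0}

lemma min (hw : IsWeight F w) (hv : IsWeight F v) : IsWeight F fun ω => min (w ω) (v ω) :=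
  ⟨hw.meas.min hv.meas, fun ω => lt_min (hw.pos ω) (hv.pos ω)⟩

lemma mul (hw : IsWeight F w) (hv : IsWeight F v) : IsWeight F fun ω => w ω * v ω :=
  ⟨hw.meas.mul hv.meas, fun ω => mul_pos (hw.pos ω) (hv.pos ω)⟩

lemma inv_one_add {a : Ω → ℝ≥0} (ha : Measurable[F] a) : IsWeight F fun ω => (1 + a ω)⁻¹ :=
  ⟨(measurable_const.add ha).inv, fun ω => by positivity⟩

lemma coe_pos (hw : IsWeight F w) (ω : Ω) : (0 : ℝ) < w ω := NNReal.coe_pos.2 (hw.pos ω)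

lemma coe_ne_zero (hw : IsWeight F w) (ω : Ω) : (w ω : ℝ) ≠ 0 := (hw.coe_pos ω).ne'

end IsWeight

/-- The partition of `Ω` into the level sets of an `F`-measurable index. -/
def fiber (κ : Ω → ℕ) (hκ : Measurable[F] κ) (k : ℕ) : FSet F :=
  ⟨κ ⁻¹' {k}, hκ (measurableSet_singleton k)⟩

lemma isPartition_fiber {κ : Ω → ℕ} (hκ : Measurable[F] κ) : IsPartition F (fiber κ hκ) :=
  ⟨fun _ _ hij => (disjoint_singleton.2 hij).preimage κ,
    eq_univ_of_forall fun ω => mem_iUnion.2 ⟨κ ω, rfl⟩⟩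

lemma IsPartition.exists_eq_fiber {A : ℕ → FSet F} (hA : IsPartition F A) :
    ∃ (κ : Ω → ℕ) (hκ : Measurable[F] κ), A = fiber κ hκ := by
  choose κ hκ using fun ω => mem_iUnion.1 (hA.2 ▸ mem_univ ω : ω ∈ ⋃ k, (A k).1)
  have hpre (k : ℕ) : (A k).1 = κ ⁻¹' {k} := by
    ext ω
    refine ⟨fun h => ?_, fun h => h ▸ hκ ω⟩
    by_contra hne
    exact disjoint_left.1 (hA.1 hne) (hκ ω) h
  exact ⟨κ, measurable_to_countable' fun k => hpre k ▸ (A k).2,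
    funext fun k => Subtype.ext (hpre k)⟩

lemma measurable_apply_index {β : Type*} [MeasurableSpace β] {κ : Ω → ℕ} (hκ : Measurable[F] κ)
    {f : ℕ → Ω → β} (hf : ∀ k, Measurable[F] (f k)) : Measurable[F] fun ω => f (κ ω) ω :=
  (measurable_from_prod_countable_right (f := fun p : ℕ × Ω => f p.1 p.2) hf).comp
    (hκ.prodMk measurable_id)

lemma exists_measurable_index {E : ℕ → Set Ω} (hE : ∀ k, MeasurableSet[F] (E k)) :
    ∃ κ : Ω → ℕ, Measurable[F] κ ∧ ∀ ω, ω ∈ ⋃ k, E k → ω ∈ E (κ ω) := by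
  classical
  have hp (ω : Ω) : ∃ k, ω ∈ E k ∪ (⋃ k, E k)ᶜ := by
    by_cases h : ω ∈ ⋃ k, E k
    · exact (mem_iUnion.1 h).imp fun k hk => Or.inl hk
    · exact ⟨0, Or.inr h⟩
  exact ⟨fun ω => Nat.find (hp ω),
    @measurable_find Ω F _ _ hp fun k => (hE k).union (MeasurableSet.iUnion hE).compl,
    fun ω hω => (Nat.find_spec (hp ω)).resolve_right (not_not_intro hω)⟩

variable [mΩ : MeasurableSpace Ω] {P : Measure Ω} {φ : ℝ≥0 → ℝ≥0∞}

/-! ### Conditional Lebesgue expectations and weights -/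

lemma lintegral_condLExp_mul (hF : F ≤ mΩ) [SigmaFinite (P.trim hF)] {c g : Ω → ℝ≥0∞}
    (hc : Measurable[F] c) (hg : AEMeasurable g P) :
    ∫⁻ ω, condLExp F P g ω * c ω ∂P = ∫⁻ ω, g ω * c ω ∂P := by
  have hc' : AEMeasurable c P := (hc.mono hF le_rfl).aemeasurable
  have key : (P.withDensity (condLExp F P g)).trim hF = (P.withDensity g).trim hF := by
    refine @Measure.ext _ F _ _ fun s hs => ?_
    rw [trim_measurableSet_eq hF hs, trim_measurableSet_eq hF hs, withDensity_apply _ (hF s hs),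
      withDensity_apply _ (hF s hs), setLIntegral_condLExp hF P g hs]
  calc ∫⁻ ω, condLExp F P g ω * c ω ∂P
      = ∫⁻ ω, c ω ∂P.withDensity (condLExp F P g) :=
        (lintegral_withDensity_eq_lintegral_mul₀ (measurable_condLExp' F P g).aemeasurable hc').symm
    _ = ∫⁻ ω, c ω ∂P.withDensity g := by
        rw [← lintegral_trim hF hc, ← lintegral_trim hF hc, key]
    _ = ∫⁻ ω, g ω * c ω ∂P := lintegral_withDensity_eq_lintegral_mul₀ hg hc'

lemma condLExp_mul_right (hF : F ≤ mΩ) [SigmaFinite (P.trim hF)] {c g : Ω → ℝ≥0∞}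
    (hc : Measurable[F] c) (hg : AEMeasurable g P) :
    condLExp F P (fun ω => g ω * c ω) =ᵐ[P] fun ω => condLExp F P g ω * c ω := by
  refine (ae_eq_condLExp hF P _ ((measurable_condLExp F P g).mul hc) fun s hs => ?_).symm
  have e := lintegral_condLExp_mul hF (hc.indicator hs) hg
  simp only [← indicator_mul_right] at e
  rwa [lintegral_indicator (hF s hs), lintegral_indicator (hF s hs)] at e

lemma condLExp_iSup (hF : F ≤ mΩ) [SigmaFinite (P.trim hF)] {g : ℕ → Ω → ℝ≥0∞}
    (hg : ∀ n, Measurable (g n)) (hmono : Monotone g) :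
    condLExp F P (fun ω => ⨆ n, g n ω) =ᵐ[P] fun ω => ⨆ n, condLExp F P (g n) ω := by
  refine (ae_eq_condLExp hF P _ (.iSup fun n => measurable_condLExp F P (g n))
    fun s hs => ?_).symm
  have hcond : ∀ᵐ ω ∂P, Monotone fun n => condLExp F P (g n) ω := by
    have hsucc (n : ℕ) : condLExp F P (g n) ≤ᵐ[P] condLExp F P (g (n + 1)) :=
      condLExp_mono (ae_of_all _ (hmono n.le_succ))
    filter_upwards [ae_all_iff.2 hsucc] with ω hω using monotone_nat_of_le_succ hω
  rw [lintegral_iSup hg hmono, lintegral_iSup'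
    (fun n => (measurable_condLExp' F P _).aemeasurable) (ae_restrict_of_ae hcond)]
  simp only [setLIntegral_condLExp hF P _ hs]

lemma condLExp_congr_of_mem (hF : F ≤ mΩ) [SigmaFinite (P.trim hF)] {g g' : Ω → ℝ≥0∞}
    (hg : AEMeasurable g P) (hg' : AEMeasurable g' P) {A : Set Ω} (hA : MeasurableSet[F] A)
    (he : ∀ᵐ ω ∂P, ω ∈ A → g ω = g' ω) :
    ∀ᵐ ω ∂P, ω ∈ A → condLExp F P g ω = condLExp F P g' ω := by
  have hm : Measurable[F] (A.indicator fun _ => (1 : ℝ≥0∞)) := measurable_const.indicator hA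
  have e : (fun ω => g ω * A.indicator (fun _ => (1 : ℝ≥0∞)) ω) =ᵐ[P]
      fun ω => g' ω * A.indicator (fun _ => (1 : ℝ≥0∞)) ω := by
    filter_upwards [he] with ω h
    by_cases hω : ω ∈ A <;> simp [hω, h]
  filter_upwards [condLExp_mul_right hF hm hg, condLExp_mul_right hF hm hg',
    condLExp_congr_ae (mΩ := F) e] with ω h1 h2 h3 hω
  simpa only [indicator_of_mem hω, mul_one] using h1.symm.trans (h3.trans h2)

namespace IsWeight

variable {w v : Ω → ℝ≥0}

lemma measurable (hw : IsWeight F w) (hF : F ≤ mΩ) : Measurable w :=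
  hw.meas.mono hF le_rfl

lemma measurable_mul (hw : IsWeight F w) (hF : F ≤ mΩ) (x : Ω →ₘ[P] ℝ) :
    Measurable fun ω => (w ω : ℝ) * x ω :=
  (hw.measurable hF).coe_nnreal_real.mul x.measurable

lemma integrable_of_le (hw : IsWeight F w) (hF : F ≤ mΩ) {x y : Ω →ₘ[P] ℝ}
    (hy : Integrable (fun ω => (v ω : ℝ) * y ω) P) (hwv : ∀ ω, w ω ≤ v ω)
    (hxy : ∀ᵐ ω ∂P, |x ω| ≤ |y ω|) : Integrable (fun ω => (w ω : ℝ) * x ω) P := by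
  refine hy.mono (hw.measurable_mul hF x).aestronglyMeasurable ?_
  filter_upwards [hxy] with ω h
  rw [norm_mul, norm_mul, NNReal.norm_eq, NNReal.norm_eq, Real.norm_eq_abs, Real.norm_eq_abs]
  exact mul_le_mul (hwv ω) h (abs_nonneg _) (v ω).coe_nonneg

end IsWeight

lemma condLExp_lt_top_iff [IsFiniteMeasure P] (hF : F ≤ mΩ) {g : Ω → ℝ≥0∞}
    (hg : AEMeasurable g P) : (∀ᵐ ω ∂P, condLExp F P g ω < ∞) ↔
      ∃ w, IsWeight F w ∧ ∫⁻ ω, g ω * w ω ∂P < ∞ := by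
  constructor
  · intro h
    have hw := IsWeight.inv_one_add (F := F) (measurable_condLExp F P g).ennreal_toNNReal
    refine ⟨_, hw, ?_⟩
    rw [← lintegral_condLExp_mul hF hw.meas.coe_nnreal_ennreal hg]
    refine lt_of_le_of_lt (lintegral_mono_ae (g := fun _ => 1) ?_)
      (by simpa only [lintegral_one] using measure_lt_top P univ)
    filter_upwards [h] with ω hω
    generalize condLExp F P g ω = t at *
    lift t to ℝ≥0 using hω.ne
    norm_cast
    rw [← div_eq_mul_inv]
    exact div_le_one_of_le₀ le_add_self (by positivity)
  · rintro ⟨w, hw, h⟩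
    rw [← lintegral_condLExp_mul hF hw.meas.coe_nnreal_ennreal hg] at h
    have hfin := ae_lt_top' ((measurable_condLExp' F P g).aemeasurable.mul
      (hw.measurable hF).coe_nnreal_ennreal.aemeasurable) h.ne
    filter_upwards [hfin] with ω hω
    by_contra hcon
    simp [not_lt_top_iff.1 hcon, ENNReal.top_mul, (hw.pos ω).ne'] at hω

/-! ### The module `L¹_F` -/

lemma mem_L1F_iff [IsFiniteMeasure P] (hF : F ≤ mΩ) {x : Ω →ₘ[P] ℝ} :
    x ∈ L1F F P ↔ ∃ w, IsWeight F w ∧ Integrable (fun ω => (w ω : ℝ) * x ω) P := by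
  rw [L1F, mem_ofPred_eq, condLExp_lt_top_iff hF x.measurable.enorm.aemeasurable]
  refine exists_congr fun w => and_congr_right fun hw => ?_
  rw [Integrable, and_iff_right (hw.measurable_mul hF x).aestronglyMeasurable, HasFiniteIntegral]
  simp only [enorm_mul, NNReal.enorm_eq, mul_comm]

lemma L1F_of_abs_le [IsFiniteMeasure P] (hF : F ≤ mΩ) {x y : Ω →ₘ[P] ℝ} (hy : y ∈ L1F F P)
    (hxy : ∀ᵐ ω ∂P, |x ω| ≤ |y ω|) : x ∈ L1F F P := by
  obtain ⟨w, hw, h⟩ := (mem_L1F_iff hF).1 hy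
  exact (mem_L1F_iff hF).2 ⟨w, hw, hw.integrable_of_le hF h (fun _ => le_rfl) hxy⟩

lemma abs_mem_L1F [IsFiniteMeasure P] (hF : F ≤ mΩ) {x : Ω →ₘ[P] ℝ} (hx : x ∈ L1F F P) :
    |x| ∈ L1F F P := by
  refine L1F_of_abs_le hF hx ?_
  filter_upwards [AEEqFun.coeFn_abs x] with ω h
  rw [h, abs_abs]

lemma exists_common_weight [IsFiniteMeasure P] (hF : F ≤ mΩ) {x y : Ω →ₘ[P] ℝ}
    (hx : x ∈ L1F F P) (hy : y ∈ L1F F P) : ∃ w, IsWeight F w ∧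
      Integrable (fun ω => (w ω : ℝ) * x ω) P ∧ Integrable (fun ω => (w ω : ℝ) * y ω) P := by
  obtain ⟨w, hw, h⟩ := (mem_L1F_iff hF).1 hx
  obtain ⟨v, hv, h'⟩ := (mem_L1F_iff hF).1 hy
  have hwv := hw.min hv
  exact ⟨_, hwv,
    hwv.integrable_of_le hF h (fun _ => min_le_left _ _) (ae_of_all _ fun _ => le_rfl),
    hwv.integrable_of_le hF h' (fun _ => min_le_right _ _) (ae_of_all _ fun _ => le_rfl)⟩

lemma coe_mul_add_ae_eq (w : Ω → ℝ≥0) (x y : Ω →ₘ[P] ℝ) :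
    (fun ω => (w ω : ℝ) * (x + y) ω) =ᵐ[P]
      (fun ω => (w ω : ℝ) * x ω) + fun ω => (w ω : ℝ) * y ω := by
  filter_upwards [AEEqFun.coeFn_add x y] with ω h
  rw [h, Pi.add_apply, Pi.add_apply, mul_add]

lemma add_mem_L1F [IsFiniteMeasure P] (hF : F ≤ mΩ) {x y : Ω →ₘ[P] ℝ} (hx : x ∈ L1F F P)
    (hy : y ∈ L1F F P) : x + y ∈ L1F F P := by
  obtain ⟨w, hw, h, h'⟩ := exists_common_weight hF hx hy
  exact (mem_L1F_iff hF).2 ⟨w, hw, (h.add h').congr (coe_mul_add_ae_eq w x y).symm⟩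

/-! ### `L⁰(F)`, indicators and partitions -/

/-- The element of `L⁰(F)` given by an `F`-measurable function. -/
def toL0F (hF : F ≤ mΩ) (f : Ω → ℝ) (hf : Measurable[F] f) : L0F F P :=
  ⟨AEEqFun.mk f (hf.mono hF le_rfl).aestronglyMeasurable,
    hf.stronglyMeasurable.aestronglyMeasurable.congr (AEEqFun.coeFn_mk _ _).symm⟩

lemma coeFn_toL0F (hF : F ≤ mΩ) (f : Ω → ℝ) (hf : Measurable[F] f) :
    ((toL0F hF f hf : L0F F P) : Ω →ₘ[P] ℝ) =ᵐ[P] f := AEEqFun.coeFn_mk _ _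

lemma exists_measurable_rep (a : L0F F P) :
    ∃ f : Ω → ℝ, Measurable[F] f ∧ (a : Ω →ₘ[P] ℝ) =ᵐ[P] f :=
  ⟨_, (AEStronglyMeasurable.stronglyMeasurable_mk a.2).measurable,
    AEStronglyMeasurable.ae_eq_mk a.2⟩

lemma L0F_ext {a b : L0F F P} (h : (a : Ω →ₘ[P] ℝ) =ᵐ[P] (b : Ω →ₘ[P] ℝ)) : a = b :=
  Subtype.ext (AEEqFun.ext h)

lemma coeFn_ind_mul (hF : F ≤ mΩ) (A : FSet F) (x : Ω →ₘ[P] ℝ) :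
    ⇑((ind P hF A : Ω →ₘ[P] ℝ) * x) =ᵐ[P] A.1.indicator x := by
  filter_upwards [AEEqFun.coeFn_mul (ind P hF A : Ω →ₘ[P] ℝ) x,
    AEEqFun.coeFn_mk (A.1.indicator fun _ => (1 : ℝ))
      ((aestronglyMeasurable_const (μ := P)).indicator (hF _ A.2))] with ω h1 h2
  rw [h1, Pi.mul_apply, show (ind P hF A : Ω →ₘ[P] ℝ) ω = _ from h2]
  by_cases hω : ω ∈ A.1 <;> simp [hω]

lemma IsPartition.ae_of_forall {A : ℕ → FSet F} (hA : IsPartition F A) {p : Ω → Prop}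
    (hp : ∀ k, ∀ᵐ ω ∂P, ω ∈ (A k).1 → p ω) : ∀ᵐ ω ∂P, p ω := by
  filter_upwards [ae_all_iff.2 hp] with ω hω
  obtain ⟨k, hk⟩ := mem_iUnion.1 (hA.2 ▸ mem_univ ω)
  exact hω k hk

/-! ### The extended conditional expectation -/

lemma integrable_indicator_and_condExp_of_weight (hF : F ≤ mΩ) {x : Ω → ℝ} {w : Ω → ℝ≥0}
    (hw : IsWeight F w) (hx : Integrable (fun ω => (w ω : ℝ) * x ω) P) {A : Set Ω}
    (hA : MeasurableSet[F] A) {C : ℝ≥0} (hC : ∀ ω ∈ A, (w ω)⁻¹ ≤ C) :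
    Integrable (A.indicator x) P ∧ P[A.indicator x | F] =ᵐ[P]
      A.indicator fun ω => (w ω : ℝ)⁻¹ * (P[fun ω => (w ω : ℝ) * x ω | F]) ω := by
  set c : Ω → ℝ := A.indicator fun ω => (w ω : ℝ)⁻¹ with hc_def
  have hc : Measurable[F] c := hw.meas.coe_nnreal_real.inv.indicator hA
  have hcx : A.indicator x = c * fun ω => (w ω : ℝ) * x ω := by
    funext ω
    by_cases hω : ω ∈ A
    · simp [hc_def, hω, inv_mul_cancel_left₀ (hw.coe_ne_zero ω)]
    · simp [hc_def, hω]
  have hcC (ω : Ω) : ‖c ω‖ ≤ C := by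
    by_cases hω : ω ∈ A
    · simpa [hc_def, hω] using NNReal.coe_le_coe.2 (hC ω hω)
    · simp [hc_def, hω]
  have hint : Integrable (c * fun ω => (w ω : ℝ) * x ω) P :=
    hx.bdd_mul (hc.mono hF le_rfl).aestronglyMeasurable (ae_of_all _ hcC)
  refine hcx ▸ ⟨hint, ?_⟩
  filter_upwards [condExp_mul_of_stronglyMeasurable_left hc.stronglyMeasurable hint hx] with ω h
  rw [h, Pi.mul_apply]
  by_cases hω : ω ∈ A <;> simp [hc_def, hω]

lemma isCondExp_of_weight (hF : F ≤ mΩ) {x : Ω →ₘ[P] ℝ} {w : Ω → ℝ≥0}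
    (hw : IsWeight F w) (hx : Integrable (fun ω => (w ω : ℝ) * x ω) P) {z : L0F F P}
    (hz : (fun ω => (w ω : ℝ) * (z : Ω →ₘ[P] ℝ) ω) =ᵐ[P] P[fun ω => (w ω : ℝ) * x ω | F]) :
    IsCondExp F P x z := by
  have hκ : Measurable[F] fun ω => ⌊(w ω)⁻¹⌋₊ := Nat.measurable_floor.comp hw.meas.inv
  refine ⟨fiber _ hκ, isPartition_fiber hκ, fun k => (ind P hF (fiber _ hκ k) : Ω →ₘ[P] ℝ) * x,
    fun k => ?_⟩
  have hC : ∀ ω ∈ (fiber _ hκ k).1, (w ω)⁻¹ ≤ (k + 1 : ℝ≥0) := by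
    rintro ω rfl
    exact (Nat.lt_floor_add_one _).le
  obtain ⟨hint, hcond⟩ :=
    integrable_indicator_and_condExp_of_weight hF hw hx (fiber _ hκ k).2 hC
  have e := coeFn_ind_mul hF (fiber _ hκ k) x
  refine ⟨hint.congr e.symm, ?_, ?_⟩
  · filter_upwards [e] with ω h hω
    rw [h, indicator_of_mem hω]
  · filter_upwards [condExp_congr_ae (m := F) e, hcond, hz] with ω h1 h2 h3 hω
    rw [h1, h2, indicator_of_mem hω, ← h3, inv_mul_cancel_left₀ (hw.coe_ne_zero ω)]

section condE

variable [IsFiniteMeasure P] {w : Ω → ℝ≥0} {x y : Ω →ₘ[P] ℝ}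

lemma weight_mul_condE (hF : F ≤ mΩ) (hw : IsWeight F w)
    (hx : Integrable (fun ω => (w ω : ℝ) * x ω) P) :
    (fun ω => (w ω : ℝ) * (condE F P x : Ω →ₘ[P] ℝ) ω) =ᵐ[P]
      P[fun ω => (w ω : ℝ) * x ω | F] := by
  have hm : Measurable[F] fun ω => (w ω : ℝ)⁻¹ * (P[fun ω => (w ω : ℝ) * x ω | F]) ω :=
    hw.meas.coe_nnreal_real.inv.mul stronglyMeasurable_condExp.measurable
  have hz : (fun ω => (w ω : ℝ) * (toL0F (P := P) hF _ hm : Ω →ₘ[P] ℝ) ω) =ᵐ[P]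
      P[fun ω => (w ω : ℝ) * x ω | F] := by
    filter_upwards [coeFn_toL0F (P := P) hF _ hm] with ω h
    rw [h, mul_inv_cancel_left₀ (hw.coe_ne_zero ω)]
  have h := isCondExp_of_weight hF hw hx hz
  have hex : ∃ z, IsCondExp F P x z := ⟨_, h⟩
  have hcondE : condE F P x = toL0F hF _ hm := by
    rw [condE, dif_pos hex]
    exact hex.choose_spec.unique h
  rwa [hcondE]

lemma condE_eq_of_weight (hF : F ≤ mΩ) (hw : IsWeight F w)
    (hx : Integrable (fun ω => (w ω : ℝ) * x ω) P) {z : L0F F P}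
    (hz : (fun ω => (w ω : ℝ) * (z : Ω →ₘ[P] ℝ) ω) =ᵐ[P] P[fun ω => (w ω : ℝ) * x ω | F]) :
    condE F P x = z := by
  refine L0F_ext ?_
  filter_upwards [weight_mul_condE hF hw hx, hz] with ω h1 h2
  exact mul_left_cancel₀ (hw.coe_ne_zero ω) (h1.trans h2.symm)

lemma integral_weight_mul_condE (hF : F ≤ mΩ) (hw : IsWeight F w)
    (hx : Integrable (fun ω => (w ω : ℝ) * x ω) P) :
    ∫ ω, (w ω : ℝ) * (condE F P x : Ω →ₘ[P] ℝ) ω ∂P = ∫ ω, (w ω : ℝ) * x ω ∂P := by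
  rw [integral_congr_ae (weight_mul_condE hF hw hx), integral_condExp hF]

lemma lintegral_enorm_weight_mul_condE_le (hF : F ≤ mΩ) (hw : IsWeight F w)
    (hx : Integrable (fun ω => (w ω : ℝ) * x ω) P) :
    ∫⁻ ω, ‖(w ω : ℝ) * (condE F P x : Ω →ₘ[P] ℝ) ω‖ₑ ∂P ≤ ∫⁻ ω, ‖(w ω : ℝ) * x ω‖ₑ ∂P := by
  have h := eLpNorm_condExp_le_eLpNorm (m := F) (μ := P) (fun ω => (w ω : ℝ) * x ω)
    (le_refl (1 : ℝ≥0∞))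
  rw [← eLpNorm_congr_ae (weight_mul_condE hF hw hx)] at h
  simpa only [eLpNorm_one_eq_lintegral_enorm] using h

lemma condE_add (hF : F ≤ mΩ) (hx : x ∈ L1F F P) (hy : y ∈ L1F F P) :
    condE F P (x + y) = condE F P x + condE F P y := by
  obtain ⟨w, hw, h, h'⟩ := exists_common_weight hF hx hy
  have e := coe_mul_add_ae_eq w x y
  refine condE_eq_of_weight hF hw ((h.add h').congr e.symm) ?_
  filter_upwards [weight_mul_condE hF hw h, weight_mul_condE hF hw h', condExp_congr_ae (m := F) e,
    condExp_add h h' F, coe_mul_add_ae_eq w (condE F P x : Ω →ₘ[P] ℝ) (condE F P y)]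
    with ω h1 h2 h3 h4 h5
  rw [Subring.coe_add, h5, h3, h4, Pi.add_apply, Pi.add_apply, h1, h2]

lemma coe_mul_mem_L1F (hF : F ≤ mΩ) (hx : x ∈ L1F F P) (a : L0F F P) :
    (a : Ω →ₘ[P] ℝ) * x ∈ L1F F P := by
  obtain ⟨b, hb, hab⟩ := exists_measurable_rep a
  have e : (fun ω => ‖((a : Ω →ₘ[P] ℝ) * x) ω‖ₑ) =ᵐ[P] fun ω => ‖x ω‖ₑ * ‖b ω‖ₑ := by
    filter_upwards [AEEqFun.coeFn_mul (a : Ω →ₘ[P] ℝ) x, hab] with ω h1 h2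
    rw [h1, Pi.mul_apply, enorm_mul, h2, mul_comm]
  rw [L1F, mem_ofPred_eq] at hx ⊢
  filter_upwards [condLExp_congr_ae (mΩ := F) e,
    condLExp_mul_right hF (measurable_enorm.comp hb) x.measurable.enorm.aemeasurable (P := P), hx]
    with ω h1 h2 h3
  rw [h1]
  exact h2.trans_lt (ENNReal.mul_lt_top h3 enorm_lt_top)

lemma condE_mul (hF : F ≤ mΩ) (hx : x ∈ L1F F P) (a : L0F F P) :
    condE F P ((a : Ω →ₘ[P] ℝ) * x) = a * condE F P x := by
  obtain ⟨w, hw, h, hax⟩ := exists_common_weight hF hx (coe_mul_mem_L1F hF hx a)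
  obtain ⟨b, hb, hab⟩ := exists_measurable_rep a
  have e : (fun ω => (w ω : ℝ) * ((a : Ω →ₘ[P] ℝ) * x) ω) =ᵐ[P] b * fun ω => (w ω : ℝ) * x ω := by
    filter_upwards [AEEqFun.coeFn_mul (a : Ω →ₘ[P] ℝ) x, hab] with ω h1 h2
    rw [h1, Pi.mul_apply, Pi.mul_apply, h2, mul_left_comm]
  refine condE_eq_of_weight hF hw hax ?_
  filter_upwards [weight_mul_condE hF hw h, condExp_congr_ae (m := F) e, hab,
    condExp_mul_of_stronglyMeasurable_left hb.stronglyMeasurable (hax.congr e) h,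
    AEEqFun.coeFn_mul (a : Ω →ₘ[P] ℝ) (condE F P x)] with ω h1 h2 h3 h4 h5
  rw [Subring.coe_mul, h5, h2, h4, Pi.mul_apply, Pi.mul_apply, ← h1, h3, mul_left_comm]

lemma abs_condE_le (hF : F ≤ mΩ) (hy : y ∈ L1F F P) (hxy : ∀ᵐ ω ∂P, |x ω| ≤ y ω) :
    ∀ᵐ ω ∂P, |(condE F P x : Ω →ₘ[P] ℝ) ω| ≤ (condE F P y : Ω →ₘ[P] ℝ) ω := by
  obtain ⟨w, hw, h⟩ := (mem_L1F_iff hF).1 hy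
  have hx := hw.integrable_of_le hF h (fun _ => le_rfl)
    (hxy.mono fun ω hω => hω.trans (le_abs_self _))
  have hle : |fun ω => (w ω : ℝ) * x ω| ≤ᵐ[P] fun ω => (w ω : ℝ) * y ω := by
    filter_upwards [hxy] with ω h1
    simp only [Pi.abs_apply, abs_mul, NNReal.abs_eq]
    gcongr
  filter_upwards [weight_mul_condE hF hw h, weight_mul_condE hF hw hx,
    abs_condExp_ae_le_condExp_abs (m := F) (μ := P) fun ω => (w ω : ℝ) * x ω,
    condExp_mono (m := F) hx.abs h hle] with ω h1 h2 h3 h4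
  have hchain := h3.trans h4
  rw [← h1, Pi.abs_apply, ← h2, abs_mul, NNReal.abs_eq] at hchain
  exact le_of_mul_le_mul_left hchain (hw.coe_pos ω)

end condE

/-! ### Concatenations -/

lemma ind_mul_eq_iff (hF : F ≤ mΩ) (A : FSet F) {x x' : Ω →ₘ[P] ℝ} :
    (ind P hF A : Ω →ₘ[P] ℝ) * x = (ind P hF A : Ω →ₘ[P] ℝ) * x' ↔
      ∀ᵐ ω ∂P, ω ∈ A.1 → x ω = x' ω := by
  constructor
  · intro h
    filter_upwards [coeFn_ind_mul hF A x, coeFn_ind_mul hF A x'] with ω h1 h2 hω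
    rwa [h, h2, indicator_of_mem hω, indicator_of_mem hω, eq_comm] at h1
  · intro h
    refine AEEqFun.ext ?_
    filter_upwards [coeFn_ind_mul hF A x, coeFn_ind_mul hF A x', h] with ω h1 h2 h3
    rw [h1, h2]
    by_cases hω : ω ∈ A.1
    · rw [indicator_of_mem hω, indicator_of_mem hω, h3 hω]
    · rw [indicator_of_notMem hω, indicator_of_notMem hω]

lemma ind_smul_L0F_eq_iff (hF : F ≤ mΩ) (A : FSet F) {a b : L0F F P} :
    ind P hF A • a = ind P hF A • b ↔
      ∀ᵐ ω ∂P, ω ∈ A.1 → (a : Ω →ₘ[P] ℝ) ω = (b : Ω →ₘ[P] ℝ) ω :=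
  Subtype.ext_iff.trans (ind_mul_eq_iff hF A)

lemma ind_smul_orlicz_eq_iff (hF : F ≤ mΩ) (hφ : IsYoung φ) (A : FSet F)
    {x x' : orlicz F P hφ} : ind P hF A • x = ind P hF A • x' ↔
      ∀ᵐ ω ∂P, ω ∈ A.1 → (x : Ω →ₘ[P] ℝ) ω = (x' : Ω →ₘ[P] ℝ) ω :=
  Subtype.ext_iff.trans (ind_mul_eq_iff hF A)

lemma IsPartition.eq_of_forall_ind_smul_eq (hF : F ≤ mΩ) {A : ℕ → FSet F}
    (hA : IsPartition F A) {a b : L0F F P}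
    (h : ∀ k, ind P hF (A k) • a = ind P hF (A k) • b) : a = b :=
  L0F_ext (hA.ae_of_forall fun k => (ind_smul_L0F_eq_iff hF (A k)).1 (h k))

lemma ind_mul_ind_of_subset (hF : F ≤ mΩ) {A B : FSet F} (h : B.1 ⊆ A.1) :
    ind P hF B * ind P hF A = ind P hF B := by
  have := (ind_smul_L0F_eq_iff (a := ind P hF A) (b := 1) hF B).2 ?_
  · rwa [smul_eq_mul, smul_eq_mul, mul_one] at this
  filter_upwards [coeFn_ind_mul hF A 1, AEEqFun.coeFn_one (μ := P) (α := Ω) (β := ℝ)]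
    with ω h1 h2 hω
  rwa [mul_one, indicator_of_mem (h hω)] at h1

lemma ind_mul_ind_of_disjoint (hF : F ≤ mΩ) {A B : FSet F} (h : Disjoint B.1 A.1) :
    ind P hF B * ind P hF A = 0 := by
  have := (ind_smul_L0F_eq_iff (a := ind P hF A) (b := 0) hF B).2 ?_
  · rwa [smul_zero] at this
  filter_upwards [coeFn_ind_mul hF A 1, AEEqFun.coeFn_zero (μ := P) (α := Ω) (β := ℝ)]
    with ω h1 h2 hω
  rw [mul_one, indicator_of_notMem (disjoint_left.1 h hω)] at h1
  rw [h1, ZeroMemClass.coe_zero, h2, Pi.zero_apply]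

lemma exists_mem_ccHull_glue (hF : F ≤ mΩ) {V : Type*} [AddCommGroup V] [Module (L0F F P) V]
    {S : Set V} {x x' : V} (hx : x ∈ S) (hx' : x' ∈ S) (A : FSet F) :
    ∃ z ∈ ccHull P hF S, ind P hF A • z = ind P hF A • x ∧
      ind P hF ⟨A.1ᶜ, A.2.compl⟩ • z = ind P hF ⟨A.1ᶜ, A.2.compl⟩ • x' := by
  classical
  have hκ : Measurable[F] fun ω => if ω ∈ A.1 then 0 else 1 :=
    Measurable.ite A.2 measurable_const measurable_const
  let z : V := ind P hF A • x + ind P hF ⟨A.1ᶜ, A.2.compl⟩ • x'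
  have hz (B : FSet F) (h : B.1 ⊆ A.1) : ind P hF B • z = ind P hF B • x := by
    rw [smul_add, smul_smul, smul_smul, ind_mul_ind_of_subset hF h,
      ind_mul_ind_of_disjoint hF (disjoint_compl_right.mono_left h), zero_smul, add_zero]
  have hz' (B : FSet F) (h : B.1 ⊆ A.1ᶜ) : ind P hF B • z = ind P hF B • x' := by
    rw [smul_add, smul_smul, smul_smul, ind_mul_ind_of_subset (A := ⟨A.1ᶜ, A.2.compl⟩) hF h,
      ind_mul_ind_of_disjoint hF (disjoint_compl_left.mono_left h), zero_smul, zero_add]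
  refine ⟨z, ⟨fiber _ hκ, isPartition_fiber hκ, fun k => if k = 0 then x else x',
    fun k => by dsimp only; split_ifs <;> assumption, fun k => ?_⟩, hz A subset_rfl,
    hz' _ subset_rfl⟩
  have hmem (ω : Ω) (hω : ω ∈ (fiber _ hκ k).1) : (if ω ∈ A.1 then 0 else 1) = k := hω
  dsimp only
  split_ifs with hk
  · refine hz _ fun ω hω => by_contra fun h => ?_
    have := hmem ω hω
    rw [if_neg h] at this
    omega
  · refine hz' _ fun ω hω h => ?_
    have := hmem ω hω
    rw [if_pos h] at this
    omega

lemma subset_ccHull (hF : F ≤ mΩ) {V : Type*} [AddCommGroup V] [Module (L0F F P) V] (S : Set V) :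
    S ⊆ ccHull P hF S := fun x hx =>
  ⟨fiber (fun _ => 0) measurable_const, isPartition_fiber measurable_const, fun _ => x,
    fun _ => hx, fun _ => rfl⟩

lemma isStable_of_isLinearMap (hF : F ≤ mΩ) {V W : Type*} [AddCommGroup V] [Module (L0F F P) V]
    [AddCommGroup W] [Module (L0F F P) W] {f : V → W} (hf : IsLinearMap (L0F F P) f) :
    IsStable P hF f := fun A _ xs x h k => by
  rw [← hf.map_smul, h k, hf.map_smul]

lemma exists_abs_eq_min_of_hasCCP (hF : F ≤ mΩ) {V : Type*} [AddCommGroup V] [Module (L0F F P) V]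
    {S : Set V} (hS : HasCCP P hF S) {f : V → L0F F P} (hf : IsLinearMap (L0F F P) f) {x x' : V}
    (hx : x ∈ S) (hx' : x' ∈ S) : ∃ z ∈ S, ∀ᵐ ω ∂P, |(f z : Ω →ₘ[P] ℝ) ω| =
      min |(f x : Ω →ₘ[P] ℝ) ω| |(f x' : Ω →ₘ[P] ℝ) ω| := by
  obtain ⟨b, hb, hxb⟩ := exists_measurable_rep (f x)
  obtain ⟨b', hb', hxb'⟩ := exists_measurable_rep (f x')
  let A : FSet F := ⟨{ω | ‖b ω‖ ≤ ‖b' ω‖},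
    measurableSet_le (measurable_norm.comp hb) (measurable_norm.comp hb')⟩
  obtain ⟨z, hz, hzx, hzx'⟩ := exists_mem_ccHull_glue (P := P) hF hx hx' A
  refine ⟨z, Eq.subset hS hz, ?_⟩
  have hon := congrArg f hzx
  have hoff := congrArg f hzx'
  rw [hf.map_smul, hf.map_smul, ind_smul_L0F_eq_iff] at hon hoff
  filter_upwards [hon, hoff, hxb, hxb'] with ω h1 h2 h3 h4
  by_cases hω : ω ∈ A.1
  · rw [h1 hω, min_eq_left]
    rwa [h3, h4]
  · rw [h2 hω, min_eq_right]
    rw [h3, h4]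
    exact (not_le.1 hω).le

lemma exists_forall_ind_mul_eq (hF : F ≤ mΩ) {A : ℕ → FSet F} (hA : IsPartition F A)
    (ys : ℕ → Ω →ₘ[P] ℝ) : ∃ y : Ω →ₘ[P] ℝ, ∀ k,
      (ind P hF (A k) : Ω →ₘ[P] ℝ) * y = (ind P hF (A k) : Ω →ₘ[P] ℝ) * ys k := by
  obtain ⟨κ, hκ, rfl⟩ := hA.exists_eq_fiber
  have hm : Measurable fun ω => ys (κ ω) ω :=
    measurable_apply_index (hκ.mono hF le_rfl) fun k => (ys k).measurable
  refine ⟨AEEqFun.mk _ hm.aestronglyMeasurable, fun k => (ind_mul_eq_iff hF _).2 ?_⟩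
  filter_upwards [AEEqFun.coeFn_mk _ (hm.aestronglyMeasurable (μ := P))] with ω h hω
  rw [h, show κ ω = k from hω]

/-! ### Elements of Orlicz-type modules -/

lemma IsYoung.exists_pos_lt_top (hφ : IsYoung φ) : ∃ t : ℝ≥0, 0 < t ∧ φ t < ∞ := by
  have h : ∀ᶠ t in 𝓝[>] (0 : ℝ≥0), φ t < ∞ := hφ.finite_near_zero.filter_mono nhdsWithin_le_nhds
  obtain ⟨t, hφt, ht⟩ := (h.and self_mem_nhdsWithin).exists
  exact ⟨t, ht, hφt⟩

lemma conj_mono (φ : ℝ≥0 → ℝ≥0∞) : Monotone (conj φ) := fun _ _ h =>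
  iSup_mono fun t => tsub_le_tsub_right (ENNReal.coe_le_coe.2 (mul_le_mul_right h t)) _

lemma coe_mul_le_add_conj (φ : ℝ≥0 → ℝ≥0∞) (t s : ℝ≥0) :
    ((t * s : ℝ≥0) : ℝ≥0∞) ≤ φ t + conj φ s :=
  tsub_le_iff_left.1 (le_iSup (fun t : ℝ≥0 => ((t * s : ℝ≥0) : ℝ≥0∞) - φ t) t)

lemma mem_orliczSet_of_abs_le {ψ : ℝ≥0 → ℝ≥0∞} (hψ : Monotone ψ) {x y : Ω →ₘ[P] ℝ}
    (hy : y ∈ orliczSet F P ψ) (hxy : ∀ᵐ ω ∂P, |x ω| ≤ |y ω|) : x ∈ orliczSet F P ψ := by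
  obtain ⟨l, hl, h⟩ := hy
  refine ⟨l, hl, ?_⟩
  have hle : (fun ω => ψ (‖x ω‖₊ * ‖(l : Ω →ₘ[P] ℝ) ω‖₊⁻¹)) ≤ᵐ[P]
      fun ω => ψ (‖y ω‖₊ * ‖(l : Ω →ₘ[P] ℝ) ω‖₊⁻¹) := by
    filter_upwards [hxy] with ω h1
    have h1' : ‖x ω‖₊ ≤ ‖y ω‖₊ := h1
    exact hψ (by gcongr)
  filter_upwards [condLExp_mono (mΩ := F) hle, h] with ω h1 h2
  exact h1.trans_lt h2

lemma mem_orliczSet_of_const (hF : F ≤ mΩ) {ψ : ℝ≥0 → ℝ≥0∞} {x : Ω →ₘ[P] ℝ} {c : ℝ≥0}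
    (hc : 0 < c) (hx : ∀ᵐ ω ∂P, condLExp F P (fun ω' => ψ (‖x ω'‖₊ * c)) ω < ∞) :
    x ∈ orliczSet F P ψ := by
  have hl := coeFn_toL0F (P := P) hF (fun _ => ((c⁻¹ : ℝ≥0) : ℝ)) measurable_const
  refine ⟨toL0F hF (fun _ => ((c⁻¹ : ℝ≥0) : ℝ)) measurable_const, ?_, ?_⟩
  · filter_upwards [hl] with ω h
    rw [h]
    exact NNReal.coe_pos.2 (inv_pos.2 hc)
  · have e : (fun ω => ψ (‖x ω‖₊ * ‖((toL0F hF (fun _ => ((c⁻¹ : ℝ≥0) : ℝ)) measurable_const :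
        L0F F P) : Ω →ₘ[P] ℝ) ω‖₊⁻¹)) =ᵐ[P] fun ω => ψ (‖x ω‖₊ * c) := by
      filter_upwards [hl] with ω h
      rw [h, NNReal.nnnorm_eq, inv_inv]
    filter_upwards [condLExp_congr_ae (mΩ := F) e, hx] with ω h1 h2
    rwa [h1]

lemma mem_orliczSet_of_bounded [IsFiniteMeasure P] (hF : F ≤ mΩ) (hφ : IsYoung φ)
    {x : Ω →ₘ[P] ℝ} (C : ℝ≥0) (hx : ∀ᵐ ω ∂P, |x ω| ≤ C) : x ∈ orliczSet F P φ := by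
  obtain ⟨t, ht, hφt⟩ := hφ.exists_pos_lt_top
  refine mem_orliczSet_of_const hF (c := t / (C + 1)) (by positivity) (condLExp_lt_top
    (ne_top_of_le_ne_top (b := ∫⁻ _, φ t ∂P) ?_ (lintegral_mono_ae ?_)))
  · rw [lintegral_const]
    exact ENNReal.mul_ne_top hφt.ne (measure_ne_top _ _)
  · filter_upwards [hx] with ω h
    have hxC : ‖x ω‖₊ ≤ C + 1 := le_trans (show ‖x ω‖₊ ≤ C from h) le_self_add
    refine hφ.mono ?_
    rw [mul_div_left_comm]
    exact mul_le_of_le_one_right' (div_le_one_of_le₀ hxC (by positivity))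

lemma measurable_comp_div {ψ : ℝ≥0 → ℝ≥0∞} (hψ : Monotone ψ) (x l : Ω →ₘ[P] ℝ) :
    Measurable fun ω => ψ (‖x ω‖₊ * ‖l ω‖₊⁻¹) :=
  hψ.measurable.comp (x.measurable.nnnorm.mul l.measurable.nnnorm.inv)

lemma exists_weight_of_mem_orliczSet [IsFiniteMeasure P] (hF : F ≤ mΩ) {ψ : ℝ≥0 → ℝ≥0∞}
    (hψ : Monotone ψ) {x : Ω →ₘ[P] ℝ} (hx : x ∈ orliczSet F P ψ) :
    ∃ w v, IsWeight F w ∧ IsWeight F v ∧ ∫⁻ ω, ψ (‖x ω‖₊ * v ω) * w ω ∂P < ∞ := by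
  obtain ⟨l, hl, h⟩ := hx
  obtain ⟨w, hw, hwi⟩ := (condLExp_lt_top_iff hF (measurable_comp_div hψ x l).aemeasurable).1 h
  obtain ⟨b, hb, hlb⟩ := exists_measurable_rep l
  have hv : IsWeight F fun ω => if 0 < b ω then ‖b ω‖₊⁻¹ else 1 := by
    refine ⟨Measurable.ite (hb measurableSet_Ioi)
      (measurable_nnnorm.comp hb).inv measurable_const, fun ω => ?_⟩
    split_ifs with h0
    · exact inv_pos.2 (nnnorm_pos.2 h0.ne')
    · exact one_pos
  refine ⟨w, _, hw, hv, lt_of_le_of_lt (lintegral_mono_ae ?_) hwi⟩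
  filter_upwards [hl, hlb] with ω h1 h2
  rw [h2] at h1 ⊢
  rw [if_pos h1]

lemma mul_mem_L1F [IsFiniteMeasure P] (hF : F ≤ mΩ) (hφ : IsYoung φ) {x y : Ω →ₘ[P] ℝ}
    (hx : x ∈ orliczSet F P φ) (hy : y ∈ orliczSet F P (conj φ)) : x * y ∈ L1F F P := by
  obtain ⟨w, v, hw, hv, hxi⟩ := exists_weight_of_mem_orliczSet hF hφ.mono hx
  obtain ⟨w', v', hw', hv', hyi⟩ := exists_weight_of_mem_orliczSet hF (conj_mono φ) hy
  have hW := (hw.min hw').mul (hv.mul hv')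
  refine (mem_L1F_iff hF).2 ⟨_, hW, (hW.measurable_mul hF _).aestronglyMeasurable, ?_⟩
  have young : ∀ᵐ ω ∂P, ‖((min (w ω) (w' ω) * (v ω * v' ω) : ℝ≥0) : ℝ) * (x * y) ω‖ₑ ≤
      φ (‖x ω‖₊ * v ω) * w ω + conj φ (‖y ω‖₊ * v' ω) * w' ω := by
    filter_upwards [AEEqFun.coeFn_mul x y] with ω h
    calc ‖((min (w ω) (w' ω) * (v ω * v' ω) : ℝ≥0) : ℝ) * (x * y) ω‖ₑ
        = ((‖x ω‖₊ * v ω * (‖y ω‖₊ * v' ω) : ℝ≥0) : ℝ≥0∞) * (min (w ω) (w' ω) : ℝ≥0) := by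
          rw [h, Pi.mul_apply, enorm_eq_nnnorm, ← ENNReal.coe_mul, nnnorm_mul, nnnorm_mul,
            NNReal.nnnorm_eq]
          congr 1
          ring
      _ ≤ (φ (‖x ω‖₊ * v ω) + conj φ (‖y ω‖₊ * v' ω)) * (min (w ω) (w' ω) : ℝ≥0) := by
          gcongr
          exact coe_mul_le_add_conj φ _ _
      _ ≤ φ (‖x ω‖₊ * v ω) * w ω + conj φ (‖y ω‖₊ * v' ω) * w' ω := by
          rw [add_mul]
          gcongr
          exacts [min_le_left _ _, min_le_right _ _]
  have hm : Measurable fun ω => φ (‖x ω‖₊ * v ω) * w ω :=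
    (hφ.mono.measurable.comp (x.measurable.nnnorm.mul (hv.measurable hF))).mul
      (hw.measurable hF).coe_nnreal_ennreal
  refine (lintegral_mono_ae young).trans_lt ?_
  rw [lintegral_add_left hm]
  exact ENNReal.add_lt_top.2 ⟨hxi, hyi⟩

lemma concat_mem_orliczSet [IsFiniteMeasure P] (hF : F ≤ mΩ) {ψ : ℝ≥0 → ℝ≥0∞} (hψ : Monotone ψ)
    {A : ℕ → FSet F} (hA : IsPartition F A) {ys : ℕ → Ω →ₘ[P] ℝ}
    (hys : ∀ k, ys k ∈ orliczSet F P ψ) {y : Ω →ₘ[P] ℝ}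
    (hy : ∀ k, ∀ᵐ ω ∂P, ω ∈ (A k).1 → y ω = ys k ω) : y ∈ orliczSet F P ψ := by
  obtain ⟨κ, hκ, rfl⟩ := hA.exists_eq_fiber
  choose l hl h using hys
  choose b hb hlb using fun k => exists_measurable_rep (l k)
  have hc : Measurable[F] fun ω => b (κ ω) ω := measurable_apply_index hκ hb
  have hcl : ∀ k, ∀ᵐ ω ∂P, ω ∈ (fiber κ hκ k).1 →
      (toL0F (P := P) hF _ hc : Ω →ₘ[P] ℝ) ω = (l k : Ω →ₘ[P] ℝ) ω := fun k => by
    filter_upwards [coeFn_toL0F (P := P) hF _ hc, hlb k] with ω h1 h2 hω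
    rw [h1, h2, show κ ω = k from hω]
  refine ⟨toL0F hF _ hc, hA.ae_of_forall fun k => ?_, hA.ae_of_forall fun k => ?_⟩
  · filter_upwards [hcl k, hl k] with ω h1 h2 hω
    rwa [h1 hω]
  · have e := condLExp_congr_of_mem hF
      (measurable_comp_div hψ y (toL0F hF _ hc : L0F F P)).aemeasurable
      (measurable_comp_div hψ (ys k) (l k)).aemeasurable (fiber κ hκ k).2 (by
        filter_upwards [hcl k, hy k] with ω h1 h2 hω
        rw [h1 hω, h2 hω])
    filter_upwards [e, h k] with ω h1 h2 hω
    rwa [h1 hω]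

lemma ccHull_image_muFun [IsFiniteMeasure P] (hF : F ≤ mΩ) (hφ : IsYoung φ) :
    ccHull P hF (muFun F P hφ '' orliczSet F P (conj φ)) =
      muFun F P hφ '' orliczSet F P (conj φ) := by
  refine Subset.antisymm ?_ (subset_ccHull hF _)
  rintro f ⟨A, hA, fs, hfs, hf⟩
  choose ys hys hyf using hfs
  obtain ⟨y, hy⟩ := exists_forall_ind_mul_eq hF hA ys
  have hym : y ∈ orliczSet F P (conj φ) :=
    concat_mem_orliczSet hF (conj_mono φ) hA hys fun k => (ind_mul_eq_iff hF (A k)).1 (hy k)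
  refine ⟨y, hym, funext fun x => hA.eq_of_forall_ind_smul_eq hF fun k => ?_⟩
  calc ind P hF (A k) • muFun F P hφ y x
      = condE F P ((ind P hF (A k) : Ω →ₘ[P] ℝ) * (x * y)) :=
        (condE_mul hF (mul_mem_L1F hF hφ x.2 hym) _).symm
    _ = condE F P ((ind P hF (A k) : Ω →ₘ[P] ℝ) * (x * ys k)) := by
        rw [mul_left_comm, hy k, mul_left_comm]
    _ = ind P hF (A k) • muFun F P hφ (ys k) x :=
        condE_mul hF (mul_mem_L1F hF hφ x.2 (hys k)) _
    _ = ind P hF (A k) • f x := by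
        rw [hyf k]
        exact (congrFun (hf k) x).symm

/-! ### Essential infima of directed sets -/

lemma exists_antitone_forall_le {α : Type*} [Preorder α] {S : Set α}
    (hdir : DirectedOn (fun a b => b ≤ a) S) {e : ℕ → α} (he : ∀ n, e n ∈ S) :
    ∃ s : ℕ → α, Antitone s ∧ ∀ n, s n ∈ S ∧ s n ≤ e n := by
  choose! m hmS hml hmr using hdir
  let s : ℕ → α := fun n => Nat.rec (e 0) (fun k a => m a (e (k + 1))) n
  have hs : ∀ n, s n ∈ S := fun n => by
    induction n with
    | zero => exact he 0
    | succ n ih => exact hmS _ ih _ (he _)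
  refine ⟨s, antitone_nat_of_succ_le fun n => hml _ (hs n) _ (he _), fun n => ⟨hs n, ?_⟩⟩
  cases n with
  | zero => exact le_rfl
  | succ n => exact hmr _ (hs n) _ (he _)

lemma ae_iInf_le_of_iInf_lintegral_le {f : ℕ → Ω → ℝ≥0∞} {g : Ω → ℝ≥0∞}
    (hf : ∀ n, Measurable (f n)) (hg : Measurable g) (hanti : ∀ n, f (n + 1) ≤ᵐ[P] f n)
    (hfin : ∫⁻ ω, f 0 ω ∂P ≠ ∞)
    (h : ∀ n, ⨅ k, ∫⁻ ω, f k ω ∂P ≤ ∫⁻ ω, min (f n ω) (g ω) ∂P) :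
    ∀ᵐ ω ∂P, ⨅ n, f n ω ≤ g ω := by
  have hmin : ∫⁻ ω, ⨅ n, min (f n ω) (g ω) ∂P = ⨅ n, ∫⁻ ω, min (f n ω) (g ω) ∂P :=
    lintegral_iInf_ae (fun n => (hf n).min hg)
      (fun n => (hanti n).mono fun ω hω => min_le_min_right _ hω)
      (ne_top_of_le_ne_top hfin (lintegral_mono fun ω => min_le_left _ _))
  have hinf : ∫⁻ ω, ⨅ n, f n ω ∂P = ⨅ n, ∫⁻ ω, f n ω ∂P := lintegral_iInf_ae hf hanti hfin
  have hle (ω : Ω) : ⨅ n, min (f n ω) (g ω) ≤ ⨅ n, f n ω := iInf_mono fun n => min_le_left _ _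
  have heq := ae_eq_of_ae_le_of_lintegral_le (ae_of_all P hle)
    (ne_top_of_le_ne_top hfin ((lintegral_mono fun ω => (hle ω).trans (iInf_le _ 0))))
    (Measurable.iInf hf).aemeasurable (by rw [hmin, hinf]; exact le_iInf h)
  filter_upwards [heq] with ω hω
  rw [← hω]
  exact (iInf_le _ 0).trans (min_le_right _ _)

/-- The truncation `min(t⁺, 1)`, which gives every random variable a finite mean. -/
def capped (t : ℝ) : ℝ≥0∞ := min (ENNReal.ofReal t) 1

lemma capped_mono : Monotone capped := fun _ _ h =>
  min_le_min_right _ (ENNReal.ofReal_le_ofReal h)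

lemma measurable_capped : Measurable capped :=
  ENNReal.measurable_ofReal.min measurable_const

lemma exists_antitone_iInf_capped_le [IsFiniteMeasure P] {S : Set (Ω →ₘ[P] ℝ)}
    (hne : S.Nonempty) (hdir : DirectedOn (fun a b => b ≤ a) S) :
    ∃ s : ℕ → Ω →ₘ[P] ℝ, Antitone s ∧ (∀ n, s n ∈ S) ∧
      ∀ d ∈ S, ∀ᵐ ω ∂P, ⨅ n, capped (s n ω) ≤ capped (d ω) := by
  let I : (Ω →ₘ[P] ℝ) → ℝ≥0∞ := fun a => ∫⁻ ω, capped (a ω) ∂P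
  have hI {a b : Ω →ₘ[P] ℝ} (h : a ≤ b) : I a ≤ I b :=
    lintegral_mono_ae ((AEEqFun.coeFn_le.2 h).mono fun _ hω => capped_mono hω)
  obtain ⟨u, -, hu, huS⟩ := exists_seq_tendsto_sInf (hne.image I) (OrderBot.bddBelow _)
  choose e heS heu using huS
  obtain ⟨s, hs, hsS⟩ := exists_antitone_forall_le hdir heS
  have hmin (d : Ω →ₘ[P] ℝ) (hd : d ∈ S) : ⨅ k, I (s k) ≤ I d :=
    calc ⨅ k, I (s k) ≤ sInf (I '' S) :=
          ge_of_tendsto' hu fun n => (iInf_le _ n).trans ((hI (hsS n).2).trans_eq (heu n))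
      _ ≤ I d := sInf_le (mem_image_of_mem I hd)
  refine ⟨s, hs, fun n => (hsS n).1, fun d hd => ae_iInf_le_of_iInf_lintegral_le
    (fun n => measurable_capped.comp (s n).measurable) (measurable_capped.comp d.measurable)
    (fun n => (AEEqFun.coeFn_le.2 (hs n.le_succ)).mono fun _ hω => capped_mono hω) ?_ fun n => ?_⟩
  · refine ne_top_of_le_ne_top (measure_ne_top P univ) ?_
    rw [← lintegral_one]
    exact lintegral_mono fun ω => min_le_right _ _
  · obtain ⟨c, hc, hcs, hcd⟩ := hdir (s n) (hsS n).1 d hd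
    refine (hmin c hc).trans (lintegral_mono_ae ?_)
    filter_upwards [AEEqFun.coeFn_le.2 hcs, AEEqFun.coeFn_le.2 hcd] with ω h h'
    exact le_min (capped_mono h) (capped_mono h')

lemma coeFn_nonneg {a : Ω →ₘ[P] ℝ} (ha : 0 ≤ a) : ∀ᵐ ω ∂P, 0 ≤ a ω := by
  filter_upwards [AEEqFun.coeFn_le.2 ha, AEEqFun.coeFn_zero (μ := P) (α := Ω) (β := ℝ)] with ω h h'
  rwa [h'] at h

lemma tendsto_zero_of_iInf_capped_eq_zero {a : ℕ → ℝ} (hanti : Antitone a) (h0 : ∀ n, 0 ≤ a n)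
    (h : ⨅ n, capped (a n) = 0) : Tendsto a atTop (𝓝 0) := by
  have hlim : Tendsto (fun n => capped (a n)) atTop (𝓝 0) :=
    h ▸ tendsto_atTop_iInf (capped_mono.comp_antitone hanti)
  refine ((ENNReal.tendsto_toReal ENNReal.zero_ne_top).comp hlim).congr' ?_
  filter_upwards [hlim.eventually_lt_const one_pos] with n hn
  rw [Function.comp_apply, capped, min_eq_left ((min_lt_iff.1 hn).resolve_right (lt_irrefl 1)).le,
    ENNReal.toReal_ofReal (h0 n)]

theorem exists_antitone_tendsto_zero [IsFiniteMeasure P] {S : Set (Ω →ₘ[P] ℝ)} (hne : S.Nonempty)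
    (hdir : DirectedOn (fun a b => b ≤ a) S) (hglb : IsGLB S 0) :
    ∃ s : ℕ → Ω →ₘ[P] ℝ, Antitone s ∧ (∀ n, s n ∈ S) ∧
      ∀ᵐ ω ∂P, Tendsto (fun n => s n ω) atTop (𝓝 0) := by
  obtain ⟨s, hs, hsS, hle⟩ := exists_antitone_iInf_capped_le hne hdir
  refine ⟨s, hs, hsS, ?_⟩
  have hm : Measurable fun ω => (⨅ n, capped (s n ω)).toReal :=
    (Measurable.iInf fun n => measurable_capped.comp (s n).measurable).ennreal_toReal
  have hmk := AEEqFun.coeFn_mk _ (hm.aestronglyMeasurable (μ := P))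
  have hlower : AEEqFun.mk _ hm.aestronglyMeasurable ∈ lowerBounds S := fun d hd => by
    rw [← AEEqFun.coeFn_le]
    filter_upwards [hmk, hle d hd, coeFn_nonneg (hglb.1 hd)] with ω h1 h2 h3
    rw [h1]
    exact ENNReal.toReal_le_of_le_ofReal h3 (h2.trans (min_le_left _ _))
  filter_upwards [hmk, AEEqFun.coeFn_le.2 (hglb.2 hlower),
    AEEqFun.coeFn_zero (μ := P) (α := Ω) (β := ℝ),
    ae_all_iff.2 fun n => coeFn_nonneg (hglb.1 (hsS n)),
    ae_all_iff.2 fun n : ℕ => AEEqFun.coeFn_le.2 (hs n.le_succ)] with ω h1 h2 h3 h0 hanti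
  rw [h1, h3] at h2
  have hfin : ⨅ n, capped (s n ω) ≠ ∞ :=
    ne_top_of_le_ne_top ENNReal.one_ne_top ((iInf_le _ 0).trans (min_le_right _ _))
  exact tendsto_zero_of_iInf_capped_eq_zero (antitone_nat_of_succ_le hanti) h0
    (((ENNReal.toReal_eq_zero_iff _).1 (h2.antisymm ENNReal.toReal_nonneg)).resolve_right hfin)

lemma zero_le_abs (x : Ω →ₘ[P] ℝ) : 0 ≤ |x| := by
  rw [← AEEqFun.coeFn_le]
  filter_upwards [AEEqFun.coeFn_abs x, AEEqFun.coeFn_zero (μ := P) (α := Ω) (β := ℝ)] with ω h h'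
  rw [h, h']
  exact abs_nonneg _

lemma exists_tendsto_zero_of_mem_orderDual [IsFiniteMeasure P] {hF : F ≤ mΩ} {hφ : IsYoung φ}
    {f : orlicz F P hφ → L0F F P} (hf : f ∈ orderDual hF hφ) {D : Set (orlicz F P hφ)}
    (hne : D.Nonempty) (hD : HasCCP P hF D)
    (hdir : DirectedOn (fun x y : orlicz F P hφ => (y : Ω →ₘ[P] ℝ) ≤ x) D)
    (hglb : IsGLB ((fun x : orlicz F P hφ => (x : Ω →ₘ[P] ℝ)) '' D) 0) :
    ∃ d : ℕ → orlicz F P hφ, (∀ n, d n ∈ D) ∧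
      ∀ᵐ ω ∂P, Tendsto (fun n => (f (d n) : Ω →ₘ[P] ℝ) ω) atTop (𝓝 0) := by
  have hdir' : DirectedOn (fun a b => b ≤ a)
      ((fun x : orlicz F P hφ => |(f x : Ω →ₘ[P] ℝ)|) '' D) := by
    rintro _ ⟨x, hx, rfl⟩ _ ⟨x', hx', rfl⟩
    obtain ⟨z, hz, hzf⟩ := exists_abs_eq_min_of_hasCCP hF hD hf.1.2 hx hx'
    refine ⟨_, mem_image_of_mem _ hz, AEEqFun.coeFn_le.1 ?_, AEEqFun.coeFn_le.1 ?_⟩ <;>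
      filter_upwards [hzf, AEEqFun.coeFn_abs (f z : Ω →ₘ[P] ℝ),
        AEEqFun.coeFn_abs (f x : Ω →ₘ[P] ℝ), AEEqFun.coeFn_abs (f x' : Ω →ₘ[P] ℝ)]
        with ω h h1 h2 h3
    · rw [h1, h2, h]
      exact min_le_left _ _
    · rw [h1, h3, h]
      exact min_le_right _ _
  obtain ⟨s, -, hs, hlim⟩ :=
    exists_antitone_tendsto_zero (hne.image _) hdir' (hf.2.2 D hne hD hdir hglb)
  choose d hd hds using hs
  refine ⟨d, hd, ?_⟩
  filter_upwards [hlim, ae_all_iff.2 fun n => AEEqFun.coeFn_abs (f (d n) : Ω →ₘ[P] ℝ)]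
    with ω h1 h2
  refine (tendsto_zero_iff_abs_tendsto_zero _).2 (h1.congr fun n => ?_)
  rw [← hds n, h2 n, Function.comp_apply]

/-! ### The functionals `μ_y` are conditionally order continuous -/

lemma nonpos_of_le_abs_condE [IsFiniteMeasure P] (hF : F ≤ mΩ) {x : ℕ → Ω →ₘ[P] ℝ}
    {z v : Ω →ₘ[P] ℝ} (hz : z ∈ L1F F P) (hxz : ∀ n, ∀ᵐ ω ∂P, |x n ω| ≤ |z ω|)
    (hx : ∀ᵐ ω ∂P, Tendsto (fun n => x n ω) atTop (𝓝 0))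
    (hv : ∀ n, ∀ᵐ ω ∂P, v ω ≤ |(condE F P (x n) : Ω →ₘ[P] ℝ) ω|) : ∀ᵐ ω ∂P, v ω ≤ 0 := by
  obtain ⟨w, hw, hi⟩ := (mem_L1F_iff hF).1 hz
  have hlim : Tendsto (fun n => ∫⁻ ω, ‖(w ω : ℝ) * x n ω‖ₑ ∂P) atTop (𝓝 (∫⁻ _, 0 ∂P)) := by
    refine tendsto_lintegral_of_dominated_convergence (fun ω => ‖(w ω : ℝ) * z ω‖ₑ)
      (fun n => (hw.measurable_mul hF (x n)).enorm) (fun n => ?_) hi.2.ne ?_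
    · filter_upwards [hxz n] with ω h
      rw [enorm_mul, enorm_mul]
      gcongr
      exact enorm_le_iff_norm_le.2 h
    · filter_upwards [hx] with ω h
      simpa using (h.const_mul (w ω : ℝ)).enorm
  have hle (n : ℕ) : ∫⁻ ω, ENNReal.ofReal (w ω * v ω) ∂P ≤ ∫⁻ ω, ‖(w ω : ℝ) * x n ω‖ₑ ∂P := by
    refine (lintegral_mono_ae ?_).trans (lintegral_enorm_weight_mul_condE_le hF hw
      (hw.integrable_of_le hF hi (fun _ => le_rfl) (hxz n)))
    filter_upwards [hv n] with ω h
    rw [← ofReal_norm, norm_mul, NNReal.norm_eq, Real.norm_eq_abs]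
    gcongr
  have hzero := ge_of_tendsto' hlim hle
  rw [lintegral_zero, nonpos_iff_eq_zero,
    lintegral_eq_zero_iff (hw.measurable_mul hF v).ennreal_ofReal] at hzero
  filter_upwards [hzero] with ω h
  exact nonpos_of_mul_nonpos_right (ENNReal.ofReal_eq_zero.1 h) (hw.coe_pos ω)

lemma ae_abs_le_of_mem_Icc {x z : Ω →ₘ[P] ℝ} (h : z ∈ Icc (-|x|) |x|) :
    ∀ᵐ ω ∂P, |z ω| ≤ |x ω| := by
  filter_upwards [AEEqFun.coeFn_le.2 h.1, AEEqFun.coeFn_le.2 h.2, AEEqFun.coeFn_abs x,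
    AEEqFun.coeFn_neg |x|] with ω h1 h2 h3 h4
  rw [h4, Pi.neg_apply, h3] at h1
  rw [h3] at h2
  exact abs_le.2 ⟨h1, h2⟩

lemma mem_Icc_of_ae_abs_le {x z : Ω →ₘ[P] ℝ} (h : ∀ᵐ ω ∂P, |z ω| ≤ x ω) : z ∈ Icc (-x) x := by
  constructor <;> rw [← AEEqFun.coeFn_le]
  · filter_upwards [h, AEEqFun.coeFn_neg x] with ω h1 h2
    rw [h2]
    exact (abs_le.1 h1).1
  · filter_upwards [h] with ω h1 using (abs_le.1 h1).2

section MuFun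

variable [IsFiniteMeasure P] {y : Ω →ₘ[P] ℝ}

lemma isLinearMap_muFun (hF : F ≤ mΩ) (hφ : IsYoung φ)
    (hy : ∀ x ∈ orlicz F P hφ, x * y ∈ L1F F P) : IsLinearMap (L0F F P) (muFun F P hφ y) where
  map_add x x' := by
    simp only [muFun, Submodule.coe_add, add_mul]
    exact condE_add hF (hy _ x.2) (hy _ x'.2)
  map_smul a x := by
    simp only [muFun, Submodule.coe_smul, Subring.smul_def, smul_eq_mul, mul_assoc]
    exact condE_mul hF (hy _ x.2) a

lemma isOrderBounded_muFun (hF : F ≤ mΩ) (hφ : IsYoung φ)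
    (hy : ∀ x ∈ orlicz F P hφ, x * y ∈ L1F F P) : IsOrderBounded hφ (muFun F P hφ y) := fun x => by
  have hbound (z : Ω →ₘ[P] ℝ) (hz : ∀ᵐ ω ∂P, |z ω| ≤ |(x : Ω →ₘ[P] ℝ) ω|) :
      ∀ᵐ ω ∂P, |(condE F P (z * y) : Ω →ₘ[P] ℝ) ω| ≤
        (condE F P |(x : Ω →ₘ[P] ℝ) * y| : Ω →ₘ[P] ℝ) ω := by
    refine abs_condE_le hF (abs_mem_L1F hF (hy x x.2)) ?_
    filter_upwards [hz, AEEqFun.coeFn_abs ((x : Ω →ₘ[P] ℝ) * y),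
      AEEqFun.coeFn_mul (x : Ω →ₘ[P] ℝ) y, AEEqFun.coeFn_mul z y] with ω h1 h2 h3 h4
    rw [h2, h3, h4, Pi.mul_apply, Pi.mul_apply, abs_mul, abs_mul]
    gcongr
  refine ⟨condE F P |(x : Ω →ₘ[P] ℝ) * y|, ?_, fun z hz =>
    mem_Icc_of_ae_abs_le (hbound z (ae_abs_le_of_mem_Icc hz))⟩
  rw [← AEEqFun.coeFn_le]
  filter_upwards [hbound x (ae_of_all _ fun _ => le_rfl),
    AEEqFun.coeFn_zero (μ := P) (α := Ω) (β := ℝ)] with ω h h'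
  rw [h']
  exact (abs_nonneg _).trans h

lemma isGLB_abs_muFun (hF : F ≤ mΩ) (hφ : IsYoung φ)
    (hy : ∀ x ∈ orlicz F P hφ, x * y ∈ L1F F P) {D : Set (orlicz F P hφ)} (hne : D.Nonempty)
    (hdir : DirectedOn (fun x y : orlicz F P hφ => (y : Ω →ₘ[P] ℝ) ≤ x) D)
    (hglb : IsGLB ((fun x : orlicz F P hφ => (x : Ω →ₘ[P] ℝ)) '' D) 0) :
    IsGLB ((fun x : orlicz F P hφ => |(muFun F P hφ y x : Ω →ₘ[P] ℝ)|) '' D) 0 := by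
  obtain ⟨s, hanti, hs, hlim⟩ := exists_antitone_tendsto_zero (hne.image _) (by
    rintro _ ⟨a, ha, rfl⟩ _ ⟨b, hb, rfl⟩
    obtain ⟨c, hc, h1, h2⟩ := hdir a ha b hb
    exact ⟨_, ⟨c, hc, rfl⟩, h1, h2⟩) hglb
  choose d hd hds using hs
  refine ⟨?_, fun v hv => ?_⟩
  · rintro _ ⟨x, _, rfl⟩
    exact zero_le_abs _
  rw [← AEEqFun.coeFn_le]
  have h0 (n : ℕ) : ∀ᵐ ω ∂P, 0 ≤ s n ω := coeFn_nonneg (hglb.1 ⟨d n, hd n, hds n⟩)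
  have hv0 := nonpos_of_le_abs_condE hF (x := fun n => s n * y) (z := s 0 * y) (v := v)
    (hds 0 ▸ hy _ (d 0).2) (fun n => ?_) ?_ fun n => ?_
  · filter_upwards [hv0, AEEqFun.coeFn_zero (μ := P) (α := Ω) (β := ℝ)] with ω h h'
    rwa [h']
  · filter_upwards [AEEqFun.coeFn_mul (s n) y, AEEqFun.coeFn_mul (s 0) y, h0 n,
      AEEqFun.coeFn_le.2 (hanti n.zero_le)] with ω h1 h2 h3 h4
    rw [h1, h2, Pi.mul_apply, Pi.mul_apply, abs_mul, abs_mul, abs_of_nonneg h3,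
      abs_of_nonneg (h3.trans h4)]
    gcongr
  · filter_upwards [hlim, ae_all_iff.2 fun n => AEEqFun.coeFn_mul (s n) y] with ω h1 h2
    simp only [h2, Pi.mul_apply]
    simpa using h1.mul_const (y ω)
  · filter_upwards [AEEqFun.coeFn_le.2 (hv ⟨d n, hd n, rfl⟩),
      AEEqFun.coeFn_abs (muFun F P hφ y (d n) : Ω →ₘ[P] ℝ)] with ω h1 h2
    rw [h2] at h1
    simpa only [muFun, hds n] using h1

theorem muFun_mem_orderDual (hF : F ≤ mΩ) (hφ : IsYoung φ)
    (hy : ∀ x ∈ orlicz F P hφ, x * y ∈ L1F F P) : muFun F P hφ y ∈ orderDual hF hφ :=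
  have hlin := isLinearMap_muFun hF hφ hy
  ⟨⟨isStable_of_isLinearMap hF hlin, hlin⟩, isOrderBounded_muFun hF hφ hy,
    fun _ hne _ hdir hglb => isGLB_abs_muFun hF hφ hy hne hdir hglb⟩

end MuFun

/-! ### Charges along random indices -/

lemma measurableSet_mem_index {N : Ω → ℕ} (hN : Measurable N) {A : ℕ → Set Ω}
    (hA : ∀ n, MeasurableSet (A n)) : MeasurableSet {ω | ω ∈ A (N ω)} :=
  measurableSet_setOfPred.2 (measurable_apply_index hN fun n => measurableSet_setOfPred.1 (hA n))

/-- A charge (finitely additive signed set function) which vanishes on null sets, is bounded by `P`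
over the sets of `F`, and is continuous from above along suitable `F`-measurable random indices.
The last property is what conditional order continuity yields in place of sequential
continuity. -/
structure IsCondCharge (F : MeasurableSpace Ω) [mΩ : MeasurableSpace Ω] (P : Measure Ω)
    (ν : Set Ω → ℝ) : Prop where
  add : ∀ A B, MeasurableSet A → MeasurableSet B → Disjoint A B → ν (A ∪ B) = ν A + ν B
  bound : ∀ A C, MeasurableSet A → MeasurableSet[F] C → |ν (A ∩ C)| ≤ P.real C
  null : ∀ A, MeasurableSet A → P A = 0 → ν A = 0
  cont : ∀ A : ℕ → Set Ω, (∀ n, MeasurableSet (A n)) → Antitone A → ⋂ n, A n = ∅ →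
    ∃ N : ℕ → Ω → ℕ, (∀ j, Measurable[F] (N j)) ∧
      Tendsto (fun j => ν {ω | ω ∈ A (N j ω)}) atTop (𝓝 0)

lemma exists_measureReal_preimage_Ioi_le [IsFiniteMeasure P] {N : Ω → ℕ} (hN : Measurable N)
    {ε : ℝ} (hε : 0 < ε) : ∃ n, P.real (N ⁻¹' Ioi n) ≤ ε := by
  have hlim : Tendsto (fun n => P (N ⁻¹' Ioi n)) atTop (𝓝 (P (⋂ n, N ⁻¹' Ioi n))) :=
    tendsto_measure_iInter_atTop (fun n => (hN measurableSet_Ioi).nullMeasurableSet)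
      (fun m n hmn => preimage_mono (Ioi_subset_Ioi hmn)) ⟨0, measure_ne_top _ _⟩
  have hempty : ⋂ n, N ⁻¹' Ioi n = ∅ := eq_empty_of_forall_notMem fun ω hω =>
    lt_irrefl (N ω) (mem_iInter.1 hω (N ω))
  rw [hempty, measure_empty] at hlim
  obtain ⟨n, hn⟩ := (hlim.eventually (gt_mem_nhds (ENNReal.ofReal_pos.2 hε))).exists
  exact ⟨n, ENNReal.toReal_le_of_le_ofReal hε.le hn.le⟩

namespace IsCondCharge

variable {ν : Set Ω → ℝ}

lemma neg (hν : IsCondCharge F P ν) : IsCondCharge F P fun A => -ν A where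
  add A B hA hB hd := by rw [hν.add A B hA hB hd, neg_add]
  bound A C hA hC := (abs_neg (ν (A ∩ C))).trans_le (hν.bound A C hA hC)
  null A hA h := by rw [hν.null A hA h, neg_zero]
  cont A hA hanti hempty := by
    obtain ⟨N, hN, hlim⟩ := hν.cont A hA hanti hempty
    exact ⟨N, hN, neg_zero (G := ℝ) ▸ hlim.neg⟩

lemma inter_add_sdiff (hν : IsCondCharge F P ν) {A B : Set Ω} (hA : MeasurableSet A)
    (hB : MeasurableSet B) : ν A = ν (A ∩ B) + ν (A \ B) := by
  rw [← hν.add _ _ (hA.inter hB) (hA.diff hB) disjoint_sdiff_inter.symm, inter_union_sdiff]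

lemma bddAbove (hν : IsCondCharge F P ν) : BddAbove {r | ∃ B, MeasurableSet B ∧ ν B = r} := by
  refine ⟨P.real univ, ?_⟩
  rintro _ ⟨B, hB, rfl⟩
  have := hν.bound B univ hB MeasurableSet.univ
  rw [inter_univ] at this
  exact (le_abs_self _).trans this

-- Take `U` nearly maximising `ν` and an index with `ν (U ∩ A_N)` small: replacing `U ∩ A_N` by any
-- subset `B` of `A_N` cannot increase `ν` by much, so `ν B` is small as well.
lemma exists_index_forall_subset_le (hν : IsCondCharge F P ν) (hF : F ≤ mΩ) {A : ℕ → Set Ω}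
    (hA : ∀ n, MeasurableSet (A n)) (hanti : Antitone A) (hempty : ⋂ n, A n = ∅) {ε : ℝ}
    (hε : 0 < ε) : ∃ N : Ω → ℕ, Measurable[F] N ∧
      ∀ B, MeasurableSet B → B ⊆ {ω | ω ∈ A (N ω)} → ν B ≤ ε := by
  obtain ⟨_, ⟨U, hU, rfl⟩, hmax⟩ := exists_lt_of_lt_csSup
    (s := {r | ∃ B, MeasurableSet B ∧ ν B = r}) ⟨_, ∅, MeasurableSet.empty, rfl⟩
    (sub_lt_self _ (half_pos hε))
  obtain ⟨N, hN, hlim⟩ := hν.cont (fun n => U ∩ A n) (fun n => hU.inter (hA n))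
    (fun _ _ hmn => inter_subset_inter_right U (hanti hmn))
    (by rw [← inter_iInter, hempty, inter_empty])
  obtain ⟨j, hj⟩ := (hlim.eventually (gt_mem_nhds (half_pos hε))).exists
  refine ⟨N j, hN j, fun B hB hBA => ?_⟩
  have hAN : MeasurableSet {ω | ω ∈ A (N j ω)} := measurableSet_mem_index ((hN j).mono hF le_rfl) hA
  have hUA : ν U = ν {ω | ω ∈ U ∩ A (N j ω)} + ν (U \ {ω | ω ∈ A (N j ω)}) :=
    hν.inter_add_sdiff hU hAN
  have hBU := hν.add B _ hB (hU.diff hAN) (disjoint_sdiff_right.mono_left hBA)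
  have hle := le_csSup hν.bddAbove ⟨_, hB.union (hU.diff hAN), rfl⟩
  linarith

lemma exists_forall_subset_le [IsFiniteMeasure P] (hν : IsCondCharge F P ν) (hF : F ≤ mΩ)
    {A : ℕ → Set Ω} (hA : ∀ n, MeasurableSet (A n)) (hanti : Antitone A) (hempty : ⋂ n, A n = ∅)
    {ε : ℝ} (hε : 0 < ε) : ∃ n, ∀ B, MeasurableSet B → B ⊆ A n → ν B ≤ ε := by
  obtain ⟨N, hN, hsmall⟩ := hν.exists_index_forall_subset_le hF hA hanti hempty (half_pos hε)
  obtain ⟨n, hn⟩ := exists_measureReal_preimage_Ioi_le (P := P) (hN.mono hF le_rfl) (half_pos hε)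
  refine ⟨n, fun B hB hBA => ?_⟩
  have hC : MeasurableSet[F] (N ⁻¹' Ioi n) := hN measurableSet_Ioi
  have hsplit := hν.inter_add_sdiff hB (hF _ hC)
  have hlarge := (le_abs_self _).trans (hν.bound B _ hB hC)
  have hrest := hsmall (B \ N ⁻¹' Ioi n) (hB.diff (hF _ hC)) fun ω hω =>
    hanti (not_lt.1 hω.2) (hBA hω.1)
  linarith

lemma exists_forall_subset_abs_le [IsFiniteMeasure P] (hν : IsCondCharge F P ν) (hF : F ≤ mΩ)
    {A : ℕ → Set Ω} (hA : ∀ n, MeasurableSet (A n)) (hanti : Antitone A) (hempty : ⋂ n, A n = ∅)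
    {ε : ℝ} (hε : 0 < ε) : ∃ n, ∀ B, MeasurableSet B → B ⊆ A n → |ν B| ≤ ε := by
  obtain ⟨n, hn⟩ := hν.exists_forall_subset_le hF hA hanti hempty hε
  obtain ⟨m, hm⟩ := hν.neg.exists_forall_subset_le hF hA hanti hempty hε
  exact ⟨max n m, fun B hB hBA =>
    abs_le'.2 ⟨hn B hB (hBA.trans (hanti (le_max_left _ _))),
      hm B hB (hBA.trans (hanti (le_max_right _ _)))⟩⟩

lemma empty (hν : IsCondCharge F P ν) : ν ∅ = 0 :=
  hν.null ∅ MeasurableSet.empty measure_empty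

lemma biUnion_finset (hν : IsCondCharge F P ν) {A : ℕ → Set Ω} (hA : ∀ i, MeasurableSet (A i))
    (hd : Pairwise (Function.onFun Disjoint A)) (s : Finset ℕ) :
    ν (⋃ i ∈ s, A i) = ∑ i ∈ s, ν (A i) := by
  induction s using Finset.induction_on with
  | empty => simp [hν.empty]
  | insert a s ha ih =>
    rw [Finset.set_biUnion_insert, Finset.sum_insert ha, ← ih]
    exact hν.add _ _ (hA a) (s.measurableSet_biUnion fun i _ => hA i)
      (disjoint_iUnion₂_right.2 fun i hi => hd fun h => ha (h ▸ hi))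

lemma hasSum_iUnion [IsFiniteMeasure P] (hν : IsCondCharge F P ν) (hF : F ≤ mΩ) {A : ℕ → Set Ω}
    (hA : ∀ i, MeasurableSet (A i)) (hd : Pairwise (Function.onFun Disjoint A)) :
    HasSum (fun i => ν (A i)) (ν (⋃ i, A i)) := by
  rw [HasSum, SummationFilter.unconditional_filter, Metric.tendsto_atTop]
  intro ε hε
  have hempty : ⋂ n, ⋃ i ≥ n, A i = ∅ := by
    refine eq_empty_of_forall_notMem fun ω hω => ?_
    obtain ⟨i, -, hi⟩ := mem_iUnion₂.1 (mem_iInter.1 hω 0)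
    obtain ⟨j, hij, hj⟩ := mem_iUnion₂.1 (mem_iInter.1 hω (i + 1))
    exact disjoint_left.1 (hd (Nat.lt_of_succ_le hij).ne) hi hj
  obtain ⟨n, hn⟩ := hν.exists_forall_subset_abs_le hF (A := fun n => ⋃ i ≥ n, A i)
    (fun n => MeasurableSet.iUnion fun i => MeasurableSet.iUnion fun _ => hA i)
    (fun m n hmn => biUnion_subset_biUnion_left fun i hi => le_trans hmn hi) hempty (half_pos hε)
  refine ⟨Finset.range n, fun s hs => ?_⟩
  have hs_meas : MeasurableSet (⋃ i ∈ s, A i) := s.measurableSet_biUnion fun i _ => hA i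
  have htail : (⋃ i, A i) \ ⋃ i ∈ s, A i ⊆ ⋃ i ≥ n, A i := fun ω ⟨hω, hωs⟩ => by
    obtain ⟨i, hi⟩ := mem_iUnion.1 hω
    exact mem_iUnion₂.2 ⟨i, not_lt.1 fun hlt =>
      hωs (mem_iUnion₂.2 ⟨i, hs (Finset.mem_range.2 hlt), hi⟩), hi⟩
  have hsplit := hν.inter_add_sdiff (MeasurableSet.iUnion hA) hs_meas
  rw [inter_eq_right.2 (iUnion₂_subset fun i _ => subset_iUnion A i)] at hsplit
  rw [← hν.biUnion_finset hA hd s, dist_comm, Real.dist_eq, hsplit, add_sub_cancel_left]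
  exact (hn _ ((MeasurableSet.iUnion hA).diff hs_meas) htail).trans_lt (half_lt_self hε)

open Classical in
theorem exists_density [IsFiniteMeasure P] (hν : IsCondCharge F P ν) (hF : F ≤ mΩ) :
    ∃ h : Ω → ℝ, Measurable h ∧ Integrable h P ∧
      ∀ A, MeasurableSet A → ν A = ∫ ω in A, h ω ∂P := by
  let κ : SignedMeasure Ω :=
    { measureOf' := fun A => if MeasurableSet A then ν A else 0
      empty' := (if_pos MeasurableSet.empty).trans hν.empty
      not_measurable' := fun A hA => if_neg hA
      m_iUnion' := fun A hA hd => by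
        simpa only [hA, if_true, MeasurableSet.iUnion hA] using hν.hasSum_iUnion hF hA hd }
  have hκ : ∀ A, MeasurableSet A → κ A = ν A := fun A hA => if_pos hA
  have hac : κ ≪ᵥ P.toENNRealVectorMeasure := by
    refine VectorMeasure.AbsolutelyContinuous.mk fun A hA h => ?_
    rw [Measure.toENNRealVectorMeasure_apply_measurable hA] at h
    rw [hκ A hA, hν.null A hA h]
  refine ⟨κ.rnDeriv P, κ.measurable_rnDeriv P, κ.integrable_rnDeriv P, fun A hA => ?_⟩
  rw [← withDensityᵥ_apply (κ.integrable_rnDeriv P) hA, κ.withDensityᵥ_rnDeriv_eq P hac, hκ A hA]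

end IsCondCharge

/-! ### Restrictions to measurable sets and uniqueness of densities -/

/-- The class in `L⁰(mΩ)` of the indicator function of `A`; for a non-measurable set, `A` is
replaced by its measurable hull. -/
def setInd (P : Measure Ω) (A : Set Ω) : Ω →ₘ[P] ℝ :=
  ind P le_rfl ⟨toMeasurable P A, measurableSet_toMeasurable P A⟩

lemma coeFn_setInd_mul {A : Set Ω} (hA : MeasurableSet A) (x : Ω →ₘ[P] ℝ) :
    ⇑(setInd P A * x) =ᵐ[P] A.indicator x :=
  (coeFn_ind_mul le_rfl _ x).trans
    (indicator_ae_eq_of_ae_eq_set hA.nullMeasurableSet.toMeasurable_ae_eq)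

lemma abs_setInd_mul_le (A : Set Ω) (x : Ω →ₘ[P] ℝ) : ∀ᵐ ω ∂P, |(setInd P A * x) ω| ≤ |x ω| := by
  filter_upwards [coeFn_ind_mul le_rfl ⟨_, measurableSet_toMeasurable P A⟩ x] with ω h
  rw [setInd, h]
  exact norm_indicator_le_norm_self (f := ⇑x) ω

lemma setInd_mul_mem_L1F [IsFiniteMeasure P] (hF : F ≤ mΩ) {x : Ω →ₘ[P] ℝ} (hx : x ∈ L1F F P)
    (A : Set Ω) : setInd P A * x ∈ L1F F P :=
  L1F_of_abs_le hF hx (abs_setInd_mul_le A x)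

lemma weight_mul_setInd_mul (w : Ω → ℝ≥0) {A : Set Ω} (hA : MeasurableSet A) (x : Ω →ₘ[P] ℝ) :
    (fun ω => (w ω : ℝ) * (setInd P A * x) ω) =ᵐ[P] A.indicator fun ω => (w ω : ℝ) * x ω := by
  filter_upwards [coeFn_setInd_mul hA x] with ω h
  rw [h, indicator_mul_right]

theorem eq_of_forall_condE_setInd_mul_eq [IsFiniteMeasure P] (hF : F ≤ mΩ) {y y' : Ω →ₘ[P] ℝ}
    (hy : y ∈ L1F F P) (hy' : y' ∈ L1F F P)
    (h : ∀ A, MeasurableSet A → condE F P (setInd P A * y) = condE F P (setInd P A * y')) :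
    y = y' := by
  obtain ⟨w, hw, hi, hi'⟩ := exists_common_weight hF hy hy'
  have hset : ∀ {x : Ω →ₘ[P] ℝ}, Integrable (fun ω => (w ω : ℝ) * x ω) P →
      ∀ A, MeasurableSet A → ∫ ω in A, (w ω : ℝ) * x ω ∂P =
        ∫ ω, (w ω : ℝ) * (condE F P (setInd P A * x) : Ω →ₘ[P] ℝ) ω ∂P := fun {x} hx A hA => by
    rw [integral_weight_mul_condE hF hw
        ((hx.indicator hA).congr (weight_mul_setInd_mul w hA x).symm),
      integral_congr_ae (weight_mul_setInd_mul w hA x), integral_indicator hA]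
  have heq := hi.ae_eq_of_forall_setIntegral_eq _ _ hi' fun A hA _ => by
    rw [hset hi A hA, hset hi' A hA, h A hA]
  refine AEEqFun.ext ?_
  filter_upwards [heq] with ω hω using mul_left_cancel₀ (hw.coe_ne_zero ω) hω

lemma orlicz_ext {hφ : IsYoung φ} {x x' : orlicz F P hφ}
    (h : (x : Ω →ₘ[P] ℝ) =ᵐ[P] (x' : Ω →ₘ[P] ℝ)) : x = x' :=
  Subtype.ext (AEEqFun.ext h)

/-- The element `1_A x` of `L^φ_F(mΩ)`. -/
def restr {hφ : IsYoung φ} (x : orlicz F P hφ) (A : Set Ω) : orlicz F P hφ :=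
  ⟨setInd P A * x, mem_orliczSet_of_abs_le hφ.mono x.2 (abs_setInd_mul_le A _)⟩

section Restr

variable {hφ : IsYoung φ} (x : orlicz F P hφ) {A B : Set Ω}

lemma coeFn_restr (hA : MeasurableSet A) :
    ⇑(restr x A : Ω →ₘ[P] ℝ) =ᵐ[P] A.indicator (x : Ω →ₘ[P] ℝ) :=
  coeFn_setInd_mul hA _

lemma restr_union (hA : MeasurableSet A) (hB : MeasurableSet B) (hd : Disjoint A B) :
    restr x (A ∪ B) = restr x A + restr x B := by
  refine orlicz_ext ?_
  filter_upwards [coeFn_restr x (hA.union hB), coeFn_restr x hA, coeFn_restr x hB,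
    AEEqFun.coeFn_add (restr x A : Ω →ₘ[P] ℝ) (restr x B)] with ω h hA hB hadd
  rw [h, Submodule.coe_add, hadd, Pi.add_apply, hA, hB, indicator_union_of_disjoint hd]

lemma restr_inter (hF : F ≤ mΩ) (hA : MeasurableSet A) (C : FSet F) :
    restr x (A ∩ C.1) = ind P hF C • restr x A := by
  refine orlicz_ext ?_
  filter_upwards [coeFn_restr x (hA.inter (hF _ C.2)), coeFn_restr x hA,
    coeFn_ind_mul hF C (restr x A : Ω →ₘ[P] ℝ)] with ω h hA hC
  rw [h, Submodule.coe_smul, Subring.smul_def, smul_eq_mul, hC, inter_comm, ← indicator_indicator]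
  by_cases hω : ω ∈ C.1 <;> simp [hω, hA]

lemma restr_eq_zero (hA : MeasurableSet A) (h0 : P A = 0) : restr x A = 0 := by
  refine orlicz_ext ?_
  filter_upwards [coeFn_restr x hA, measure_eq_zero_iff_ae_notMem.1 h0,
    AEEqFun.coeFn_zero (μ := P) (β := ℝ)] with ω h hω h0
  rw [h, indicator_of_notMem hω, Submodule.coe_zero, h0, Pi.zero_apply]

end Restr

lemma one_mem_orlicz [IsFiniteMeasure P] (hF : F ≤ mΩ) (hφ : IsYoung φ) :
    (1 : Ω →ₘ[P] ℝ) ∈ orlicz F P hφ := mem_orliczSet_of_bounded hF hφ 1 <| by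
  filter_upwards [AEEqFun.coeFn_one (μ := P) (β := ℝ)] with ω h
  simp [h]

lemma injOn_muFun [IsFiniteMeasure P] (hF : F ≤ mΩ) (hφ : IsYoung φ) :
    InjOn (muFun F P hφ) (orliczSet F P (conj φ)) := by
  have hL1 : ∀ y ∈ orliczSet F P (conj φ), y ∈ L1F F P := fun y hy =>
    one_mul y ▸ mul_mem_L1F hF hφ (one_mem_orlicz hF hφ) hy
  intro y hy y' hy' h
  refine eq_of_forall_condE_setInd_mul_eq hF (hL1 y hy) (hL1 y' hy') fun A _ => ?_
  simpa only [muFun, restr, mul_one] using congrFun h (restr ⟨1, one_mem_orlicz hF hφ⟩ A)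

/-! ### Densities of order continuous functionals -/

lemma IsOrderBounded.exists_weight {hφ : IsYoung φ} {f : orlicz F P hφ → L0F F P}
    (hf : IsOrderBounded hφ f) (x : orlicz F P hφ) : ∃ w, IsWeight F w ∧
      ∀ z : orlicz F P hφ, (∀ᵐ ω ∂P, |(z : Ω →ₘ[P] ℝ) ω| ≤ |(x : Ω →ₘ[P] ℝ) ω|) →
        ∀ᵐ ω ∂P, ‖(w ω : ℝ) * (f z : Ω →ₘ[P] ℝ) ω‖ ≤ 1 := by
  obtain ⟨y, -, hy⟩ := hf x
  obtain ⟨b, hb, hyb⟩ := exists_measurable_rep y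
  refine ⟨_, .inv_one_add (measurable_nnnorm.comp hb), fun z hz => ?_⟩
  have hzx : (z : Ω →ₘ[P] ℝ) ∈ Icc (-|(x : Ω →ₘ[P] ℝ)|) |(x : Ω →ₘ[P] ℝ)| :=
    mem_Icc_of_ae_abs_le <| by
      filter_upwards [hz, AEEqFun.coeFn_abs (x : Ω →ₘ[P] ℝ)] with ω h1 h2
      rwa [h2]
  filter_upwards [AEEqFun.coeFn_le.2 (hy z hzx).1, AEEqFun.coeFn_le.2 (hy z hzx).2, hyb,
    AEEqFun.coeFn_neg (y : Ω →ₘ[P] ℝ)] with ω hlo hhi hb hneg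
  rw [hneg, Pi.neg_apply, hb] at hlo
  rw [hb] at hhi
  have hfz : |(f z : Ω →ₘ[P] ℝ) ω| ≤ 1 + ‖b ω‖ :=
    (abs_le.2 ⟨hlo, hhi⟩).trans ((le_abs_self _).trans (le_add_of_nonneg_left zero_le_one))
  rw [norm_mul, Real.norm_eq_abs, Real.norm_eq_abs, NNReal.abs_eq, NNReal.coe_inv,
    NNReal.coe_add, NNReal.coe_one, Function.comp_apply, coe_nnnorm,
    inv_mul_le_iff₀ (by positivity), mul_one]
  exact hfz

/-- The restrictions of `x` to the sets `A_N` with an `F`-measurable random index `N`; for a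
decreasing sequence `A` they form the downward directed family to which conditional order
continuity is applied. -/
def indexRestr {hφ : IsYoung φ} (x : orlicz F P hφ) (A : ℕ → Set Ω) : Set (orlicz F P hφ) :=
  {z | ∃ N : Ω → ℕ, Measurable[F] N ∧ z = restr x {ω | ω ∈ A (N ω)}}

section IndexRestr

variable {hφ : IsYoung φ} {x : orlicz F P hφ} {A : ℕ → Set Ω}

lemma hasCCP_indexRestr (hF : F ≤ mΩ) (x : orlicz F P hφ) (hA : ∀ n, MeasurableSet (A n)) :
    HasCCP P hF (indexRestr x A) := by
  refine Subset.antisymm ?_ (subset_ccHull hF _)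
  rintro z ⟨B, hB, zs, hzs, hz⟩
  obtain ⟨κ, hκ, rfl⟩ := hB.exists_eq_fiber
  choose N hN hzN using hzs
  have hNκ : Measurable[F] fun ω => N (κ ω) ω := measurable_apply_index hκ hN
  refine ⟨_, hNκ, orlicz_ext ?_⟩
  have hNA := fun {N} (hN : Measurable[F] N) =>
    coeFn_restr x (measurableSet_mem_index (hN.mono hF le_rfl) hA)
  filter_upwards [hNA hNκ, ae_all_iff.2 fun k => hNA (hN k),
    ae_all_iff.2 fun k => (ind_smul_orlicz_eq_iff hF hφ _).1 (hz k)] with ω hκN hkN hzk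
  rw [hzk (κ ω) rfl, hzN, hkN, hκN]
  rfl

lemma directedOn_indexRestr (hF : F ≤ mΩ) (hx : ∀ᵐ ω ∂P, 0 ≤ (x : Ω →ₘ[P] ℝ) ω)
    (hA : ∀ n, MeasurableSet (A n)) (hanti : Antitone A) :
    DirectedOn (fun z z' : orlicz F P hφ => (z' : Ω →ₘ[P] ℝ) ≤ z) (indexRestr x A) := by
  have hmono : ∀ {N N' : Ω → ℕ}, Measurable[F] N → Measurable[F] N' → (∀ ω, N ω ≤ N' ω) →
      (restr x {ω | ω ∈ A (N' ω)} : Ω →ₘ[P] ℝ) ≤ restr x {ω | ω ∈ A (N ω)} :=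
    fun {N N'} hN hN' hle => AEEqFun.coeFn_le.1 <| by
      filter_upwards [hx, coeFn_restr x (measurableSet_mem_index (hN.mono hF le_rfl) hA),
        coeFn_restr x (measurableSet_mem_index (hN'.mono hF le_rfl) hA)] with ω h0 h1 h2
      rw [h1, h2]
      exact indicator_le_indicator_apply_of_subset (fun ω' hω' => hanti (hle ω') hω') h0
  rintro _ ⟨N, hN, rfl⟩ _ ⟨N', hN', rfl⟩
  exact ⟨_, ⟨_, hN.max hN', rfl⟩, hmono hN (hN.max hN') fun ω => le_max_left _ _,
    hmono hN' (hN.max hN') fun ω => le_max_right _ _⟩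

lemma isGLB_indexRestr (hF : F ≤ mΩ) (hx : ∀ᵐ ω ∂P, 0 ≤ (x : Ω →ₘ[P] ℝ) ω)
    (hA : ∀ n, MeasurableSet (A n)) (hempty : ⋂ n, A n = ∅) :
    IsGLB ((fun z : orlicz F P hφ => (z : Ω →ₘ[P] ℝ)) '' indexRestr x A) 0 := by
  constructor
  · rintro _ ⟨_, ⟨N, hN, rfl⟩, rfl⟩
    refine AEEqFun.coeFn_le.1 ?_
    filter_upwards [hx, AEEqFun.coeFn_zero (μ := P) (β := ℝ),
      coeFn_restr x (measurableSet_mem_index (hN.mono hF le_rfl) hA)] with ω hx0 h0 hN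
    rw [h0, hN]
    exact indicator_apply_nonneg fun _ => hx0
  · intro v hv
    have hvA : ∀ n, (v : Ω → ℝ) ≤ᵐ[P] (A n).indicator (x : Ω →ₘ[P] ℝ) := fun n =>
      (AEEqFun.coeFn_le.2 (hv ⟨_, ⟨fun _ => n, measurable_const, rfl⟩, rfl⟩)).trans_eq
        (coeFn_restr x (hA n))
    refine AEEqFun.coeFn_le.1 ?_
    filter_upwards [ae_all_iff.2 hvA, AEEqFun.coeFn_zero (μ := P) (β := ℝ)] with ω hv h0
    obtain ⟨n, hn⟩ : ∃ n, ω ∉ A n := by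
      by_contra! h
      exact notMem_empty ω (hempty ▸ mem_iInter.2 h)
    rw [h0]
    simpa only [indicator_of_notMem hn, Pi.zero_apply] using hv n

end IndexRestr

/-- `g` is a density of the `L⁰(F)`-valued set function `A ↦ f(1_A x)`, with respect to conditional
expectation. -/
structure IsDensity {hφ : IsYoung φ} (f : orlicz F P hφ → L0F F P) (x : orlicz F P hφ)
    (g : Ω →ₘ[P] ℝ) : Prop where
  mem_L1F : g ∈ L1F F P
  map_restr : ∀ A, MeasurableSet A → f (restr x A) = condE F P (setInd P A * g)

section Density

variable {hφ : IsYoung φ} {f : orlicz F P hφ → L0F F P} {x : orlicz F P hφ} {w : Ω → ℝ≥0}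

lemma integral_weight_mul_map_restr_inter (hF : F ≤ mΩ) (hf : IsLinearMap (L0F F P) f)
    (w : Ω → ℝ≥0) {A : Set Ω} (hA : MeasurableSet A) {C : Set Ω} (hC : MeasurableSet[F] C) :
    ∫ ω, (w ω : ℝ) * (f (restr x (A ∩ C)) : Ω →ₘ[P] ℝ) ω ∂P =
      ∫ ω in C, (w ω : ℝ) * (f (restr x A) : Ω →ₘ[P] ℝ) ω ∂P := by
  rw [restr_inter x hF hA ⟨C, hC⟩, hf.map_smul, ← integral_indicator (hF _ hC)]
  refine integral_congr_ae ?_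
  filter_upwards [coeFn_ind_mul hF ⟨C, hC⟩ (f (restr x A) : Ω →ₘ[P] ℝ)] with ω h
  rw [smul_eq_mul, Subring.coe_mul, h, indicator_mul_right]

lemma integrable_weight_mul_of_bound [IsFiniteMeasure P] (hF : F ≤ mΩ) (hw : IsWeight F w)
    {z : Ω →ₘ[P] ℝ} (hz : ∀ᵐ ω ∂P, ‖(w ω : ℝ) * z ω‖ ≤ 1) :
    Integrable (fun ω => (w ω : ℝ) * z ω) P :=
  Integrable.of_bound (hw.measurable_mul hF z).aestronglyMeasurable 1 hz

variable [IsFiniteMeasure P] {hF : F ≤ mΩ}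

lemma isCondCharge_of_mem_orderDual (hf : f ∈ orderDual hF hφ)
    (hx : ∀ᵐ ω ∂P, 0 ≤ (x : Ω →ₘ[P] ℝ) ω) (hw : IsWeight F w)
    (hwf : ∀ A, ∀ᵐ ω ∂P, ‖(w ω : ℝ) * (f (restr x A) : Ω →ₘ[P] ℝ) ω‖ ≤ 1) :
    IsCondCharge F P fun A => ∫ ω, (w ω : ℝ) * (f (restr x A) : Ω →ₘ[P] ℝ) ω ∂P where
  add A B hA hB hd := by
    rw [restr_union x hA hB hd, hf.1.2.map_add, Subring.coe_add,
      integral_congr_ae (coe_mul_add_ae_eq w _ _)]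
    exact integral_add (integrable_weight_mul_of_bound hF hw (hwf A))
      (integrable_weight_mul_of_bound hF hw (hwf B))
  bound A C hA hC := by
    rw [integral_weight_mul_map_restr_inter hF hf.1.2 w hA hC]
    exact (norm_setIntegral_le_of_norm_le_const_ae (measure_lt_top _ _)
      (ae_restrict_of_ae (hwf A))).trans (one_mul _).le
  null A hA h0 := by
    rw [restr_eq_zero x hA h0, hf.1.2.map_zero]
    refine integral_eq_zero_of_ae ?_
    filter_upwards [AEEqFun.coeFn_zero (μ := P) (β := ℝ)] with ω h
    rw [Subring.coe_zero, h, Pi.zero_apply, mul_zero]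
  cont A hA hanti hempty := by
    obtain ⟨d, hd, hlim⟩ := exists_tendsto_zero_of_mem_orderDual hf (D := indexRestr x A)
      ⟨_, fun _ => 0, measurable_const, rfl⟩ (hasCCP_indexRestr hF x hA)
      (directedOn_indexRestr hF hx hA hanti) (isGLB_indexRestr hF hx hA hempty)
    choose N hN hdN using hd
    refine ⟨N, hN, ?_⟩
    simp only [hdN] at hlim
    have hdom := tendsto_integral_of_dominated_convergence (f := fun _ => (0 : ℝ))
      (F := fun j ω => (w ω : ℝ) * (f (restr x {ω | ω ∈ A (N j ω)}) : Ω →ₘ[P] ℝ) ω) (fun _ => 1)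
      (fun j => (hw.measurable_mul hF _).aestronglyMeasurable)
      (integrable_const 1) (fun j => hwf _) (hlim.mono fun ω h => by
        simpa only [mul_zero] using h.const_mul (w ω : ℝ))
    rwa [integral_zero] at hdom

theorem exists_density_of_mem_orderDual (hf : f ∈ orderDual hF hφ)
    (hx : ∀ᵐ ω ∂P, 0 ≤ (x : Ω →ₘ[P] ℝ) ω) :
    ∃ g, IsDensity f x g := by
  obtain ⟨w, hw, hbound⟩ := hf.2.1.exists_weight x
  have hwf := fun A => hbound (restr x A) (abs_setInd_mul_le A _)
  obtain ⟨h, hh, hhi, hdens⟩ := (isCondCharge_of_mem_orderDual hf hx hw hwf).exists_density hF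
  have hg : Measurable fun ω => (w ω : ℝ)⁻¹ * h ω :=
    (hw.measurable hF).coe_nnreal_real.inv.mul hh
  set g : Ω →ₘ[P] ℝ := AEEqFun.mk _ hg.aestronglyMeasurable
  have hgh : (fun ω => (w ω : ℝ) * g ω) =ᵐ[P] h := by
    filter_upwards [AEEqFun.coeFn_mk _ (hg.aestronglyMeasurable (μ := P))] with ω hω
    rw [hω, mul_inv_cancel_left₀ (hw.coe_ne_zero ω)]
  refine ⟨g, (mem_L1F_iff hF).2 ⟨w, hw, hhi.congr hgh.symm⟩, fun A hA => ?_⟩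
  have hAg : (fun ω => (w ω : ℝ) * (setInd P A * g) ω) =ᵐ[P] A.indicator h :=
    (weight_mul_setInd_mul w hA g).trans hgh.indicator
  have hAh := hhi.indicator hA
  refine (condE_eq_of_weight hF hw (hAh.congr hAg.symm) ?_).symm
  refine (ae_eq_condExp_of_forall_setIntegral_eq hF hAh
    (fun C _ _ => (integrable_weight_mul_of_bound hF hw (hwf A)).integrableOn)
    (fun C hC _ => ?_) ?_).trans (condExp_congr_ae hAg.symm)
  · rw [setIntegral_indicator hA, inter_comm, ← hdens _ (hA.inter (hF C hC)),
      integral_weight_mul_map_restr_inter hF hf.1.2 w hA hC]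
  · exact hw.meas.coe_nnreal_real.stronglyMeasurable.aestronglyMeasurable.mul (f (restr x A)).2

end Density

/-! ### Converse Hölder inequality -/

lemma IsYoung.map_mul_le (hφ : IsYoung φ) {c : ℝ≥0} (hc : c ≤ 1) (t : ℝ≥0) :
    φ (c * t) ≤ c * φ t := by
  have h := hφ.convex.2 (mem_univ t) (mem_univ 0) (zero_le (a := c)) (zero_le (a := 1 - c))
    (add_tsub_cancel_of_le hc)
  simpa [hφ.map_zero, ENNReal.smul_def] using h

lemma IsYoung.bddAbove_range (hφ : IsYoung φ) {q : ℕ → ℝ≥0} (hq : ∑' k, φ (q k) < ∞) :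
    BddAbove (range q) := by
  obtain ⟨T, hT⟩ := (hφ.tendsto_top.eventually (lt_mem_nhds hq)).exists
  refine ⟨T, forall_mem_range.2 fun k => ?_⟩
  by_contra! h
  exact ((ENNReal.le_tsum k).trans_lt hT).not_ge (hφ.mono h.le)

lemma IsYoung.map_iSup_le (hφ : IsYoung φ) {q : ℕ → ℝ≥0} (hq : ∑' k, φ (q k) < ∞) :
    φ (⨆ k, q k) ≤ ∑' k, φ (q k) := by
  have hb := hφ.bddAbove_range hq
  rw [iSup, MonotoneOn.map_csSup_of_continuousWithinAt
    ((hφ.leftContinuous _).mono fun a ha => le_csSup hb ha) (hφ.mono.monotoneOn _)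
    (range_nonempty q) hb]
  refine sSup_le ?_
  rintro _ ⟨_, ⟨k, rfl⟩, rfl⟩
  exact ENNReal.le_tsum k

lemma conj_eq_iSup_of_denseRange (hφ : Monotone φ) {t : ℕ → ℝ≥0} (ht : DenseRange t) (s : ℝ≥0) :
    conj φ s = ⨆ j, ((t j * s : ℝ≥0) : ℝ≥0∞) - φ (t j) := by
  refine le_antisymm (iSup_le fun r => le_of_forall_lt fun c hc => ?_)
    (iSup_le fun j => le_iSup (fun t : ℝ≥0 => ((t * s : ℝ≥0) : ℝ≥0∞) - φ t) (t j))
  -- By monotonicity a dense point slightly below `r` is as good as `r`.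
  have hlt : c + φ r < ((r * s : ℝ≥0) : ℝ≥0∞) := lt_tsub_iff_right.1 hc
  obtain ⟨d, hd⟩ : ∃ d : ℝ≥0, (d : ℝ≥0∞) = c + φ r := ⟨_, ENNReal.coe_toNNReal hlt.ne_top⟩
  rw [← hd, ENNReal.coe_lt_coe] at hlt
  have hs : 0 < s := pos_iff_ne_zero.2 fun h => by simp [h] at hlt
  obtain ⟨j, hdj, hjr⟩ := ht.exists_mem_open isOpen_Ioo
    (nonempty_Ioo.2 ((div_lt_iff₀ hs).2 hlt))
  refine lt_of_lt_of_le (lt_tsub_iff_right.2 ?_) (le_iSup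
    (fun j => ((t j * s : ℝ≥0) : ℝ≥0∞) - φ (t j)) j)
  calc c + φ (t j) ≤ c + φ r := add_le_add_right (hφ hjr.le) c
    _ = d := hd.symm
    _ < ((t j * s : ℝ≥0) : ℝ≥0∞) := ENNReal.coe_lt_coe.2 ((div_lt_iff₀ hs).1 hdj)

/-- The quantity `t s - φ(t)`, truncated at `0`, whose supremum over `t` is `φ*(s)`. -/
def conjObjective (φ : ℝ≥0 → ℝ≥0∞) (t s : ℝ≥0) : ℝ≥0∞ := ((t * s : ℝ≥0) : ℝ≥0∞) - φ t

/-- A maximiser of `t s - φ(t)` over `t = 0` and the first `m` terms of a fixed dense sequence.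
It serves as a measurable approximate maximiser in the definition of `φ*(s)`. -/
def maximiser (φ : ℝ≥0 → ℝ≥0∞) : ℕ → ℝ≥0 → ℝ≥0
  | 0, _ => 0
  | m + 1, s =>
    if conjObjective φ (maximiser φ m s) s < conjObjective φ (TopologicalSpace.denseSeq ℝ≥0 m) s
    then TopologicalSpace.denseSeq ℝ≥0 m else maximiser φ m s

lemma measurable_conjObjective_comp {α : Type*} {_ : MeasurableSpace α} (hφ : Monotone φ)
    {t s : α → ℝ≥0} (ht : Measurable t) (hs : Measurable s) :
    Measurable fun a => conjObjective φ (t a) (s a) :=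
  (ht.mul hs).coe_nnreal_ennreal.sub (hφ.measurable.comp ht)

lemma measurable_maximiser (hφ : Monotone φ) : ∀ m, Measurable (maximiser φ m)
  | 0 => measurable_const
  | m + 1 =>
    Measurable.ite (measurableSet_lt
        (measurable_conjObjective_comp hφ (measurable_maximiser hφ m) measurable_id)
        (measurable_conjObjective_comp hφ measurable_const measurable_id))
      measurable_const (measurable_maximiser hφ m)

lemma conjObjective_maximiser_succ (φ : ℝ≥0 → ℝ≥0∞) (m : ℕ) (s : ℝ≥0) :
    conjObjective φ (maximiser φ (m + 1) s) s = max (conjObjective φ (maximiser φ m s) s)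
      (conjObjective φ (TopologicalSpace.denseSeq ℝ≥0 m) s) := by
  rw [maximiser]
  split_ifs with h
  · exact (max_eq_right h.le).symm
  · exact (max_eq_left (not_lt.1 h)).symm

lemma monotone_conjObjective_maximiser (φ : ℝ≥0 → ℝ≥0∞) :
    Monotone fun m s => conjObjective φ (maximiser φ m s) s :=
  monotone_nat_of_le_succ fun m s => (le_max_left _ _).trans (conjObjective_maximiser_succ φ m s).ge

lemma iSup_conjObjective_maximiser (hφ : Monotone φ) (s : ℝ≥0) :
    ⨆ m, conjObjective φ (maximiser φ m s) s = conj φ s := by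
  refine le_antisymm (iSup_le fun m => le_iSup (fun t => conjObjective φ t s) _) ?_
  rw [conj_eq_iSup_of_denseRange hφ (TopologicalSpace.denseRange_denseSeq ℝ≥0)]
  exact iSup_mono' fun m =>
    ⟨m + 1, (le_max_right _ _).trans (conjObjective_maximiser_succ φ m s).ge⟩

lemma IsYoung.map_maximiser_add (hφ : IsYoung φ) (m : ℕ) (s : ℝ≥0) :
    φ (maximiser φ m s) + conjObjective φ (maximiser φ m s) s = (maximiser φ m s * s : ℝ≥0) := by
  refine add_tsub_cancel_of_le ?_
  induction m with
  | zero => simp [maximiser, hφ.map_zero]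
  | succ m ih =>
    rw [maximiser]
    split_ifs with h
    · exact (tsub_pos_iff_lt.1 (bot_le.trans_lt h)).le
    · exact ih

lemma IsYoung.exists_forall_map_maximiser_le (hφ : IsYoung φ) (m : ℕ) :
    ∃ M : ℝ≥0, ∀ s, φ (maximiser φ m s) ≤ M := by
  induction m with
  | zero => exact ⟨0, fun s => by simp [maximiser, hφ.map_zero]⟩
  | succ m ih =>
    obtain ⟨M, hM⟩ := ih
    refine ⟨max M (φ (TopologicalSpace.denseSeq ℝ≥0 m)).toNNReal, fun s => ?_⟩
    rw [maximiser]
    split_ifs with h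
    · have hlt := tsub_pos_iff_lt.1 (bot_le.trans_lt h)
      rw [← ENNReal.coe_toNNReal hlt.ne_top]
      exact ENNReal.coe_le_coe.2 (le_max_right _ _)
    · exact (hM s).trans (ENNReal.coe_le_coe.2 (le_max_left _ _))

lemma exists_normalized [IsFiniteMeasure P] (hF : F ≤ mΩ) (hφ : IsYoung φ) {X : Ω → ℝ≥0}
    (hX : Measurable X) (hφX : ∀ᵐ ω ∂P, condLExp F P (fun ω => φ (X ω)) ω < ∞) :
    ∃ x : Ω → ℝ≥0, Measurable x ∧ (∀ᵐ ω ∂P, condLExp F P (fun ω => φ (x ω)) ω ≤ 1) ∧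
      ∀ {a : Ω → ℝ≥0} {g : Ω → ℝ≥0∞}, Measurable a → (∀ ω, φ (X ω) + g ω = (X ω * a ω : ℝ≥0)) →
        ∀ᵐ ω ∂P, 1 ≤ condLExp F P g ω →
          1 ≤ condLExp F P (fun ω => ((x ω * a ω : ℝ≥0) : ℝ≥0∞)) ω := by
  set α := condLExp F P fun ω => φ (X ω)
  let r : Ω → ℝ≥0 := fun ω => (max (α ω).toNNReal 1)⁻¹
  have hr : Measurable[F] r :=
    ((measurable_condLExp F P _).ennreal_toNNReal.max measurable_const).inv
  have hφm : Measurable fun ω => φ (X ω) := hφ.mono.measurable.comp hX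
  refine ⟨fun ω => r ω * X ω, (hr.mono hF le_rfl).mul hX, ?_, fun {a g} ha hg => ?_⟩
  · have hle (ω : Ω) : φ (r ω * X ω) ≤ φ (X ω) * r ω :=
      (hφ.map_mul_le (inv_le_one_of_one_le₀ (le_max_right _ _)) _).trans_eq (mul_comm _ _)
    filter_upwards [condLExp_mono (mΩ := F) (ae_of_all P hle),
      condLExp_mul_right hF hr.coe_nnreal_ennreal hφm.aemeasurable, hφX] with ω h1 h2 h3
    refine h1.trans (h2.trans_le ?_)
    change α ω * r ω ≤ 1
    rw [← ENNReal.coe_toNNReal h3.ne]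
    exact_mod_cast mul_inv_le_one_of_le₀ (le_max_left _ _) (by positivity)
  · have hxa : (fun ω => ((r ω * X ω * a ω : ℝ≥0) : ℝ≥0∞)) =
        fun ω => (φ (X ω) + g ω) * r ω := funext fun ω => by
      rw [hg, ← ENNReal.coe_mul, mul_assoc, mul_comm]
    have hm : Measurable fun ω => φ (X ω) + g ω := by
      simp only [hg]
      exact (hX.mul ha).coe_nnreal_ennreal
    filter_upwards [condLExp_mul_right hF hr.coe_nnreal_ennreal hm.aemeasurable,
      condLExp_add_left (mΩ := F) g hφm.aemeasurable, hφX] with ω h1 h2 h3 h4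
    rw [hxa, h1, show condLExp F P (fun ω => φ (X ω) + g ω) ω = α ω + condLExp F P g ω from h2]
    calc (1 : ℝ≥0∞) ≤ ((((α ω).toNNReal + 1) * r ω : ℝ≥0) : ℝ≥0∞) := by
          rw [ENNReal.one_le_coe_iff, ← div_eq_mul_inv, one_le_div₀ (by positivity)]
          exact max_le le_self_add le_add_self
      _ ≤ (α ω + condLExp F P g ω) * r ω := by
          rw [ENNReal.coe_mul, ENNReal.coe_add, ENNReal.coe_toNNReal h3.ne, ENNReal.coe_one]
          gcongr

lemma exists_seq_eventually_one_le_condLExp_mul [IsFiniteMeasure P] (hF : F ≤ mΩ) (hφ : IsYoung φ)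
    {a : Ω → ℝ≥0} (ha : Measurable a) :
    ∃ x : ℕ → Ω → ℝ≥0, (∀ m, Measurable (x m)) ∧
      (∀ m, ∀ᵐ ω ∂P, condLExp F P (fun ω => φ (x m ω)) ω ≤ 1) ∧
      ∀ᵐ ω ∂P, condLExp F P (fun ω => conj φ (a ω)) ω = ∞ →
        ∀ᶠ m in atTop, 1 ≤ condLExp F P (fun ω => ((x m ω * a ω : ℝ≥0) : ℝ≥0∞)) ω := by
  have hX (m : ℕ) : Measurable fun ω => maximiser φ m (a ω) :=
    (measurable_maximiser hφ.mono m).comp ha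
  have hfin (m : ℕ) : ∀ᵐ ω ∂P, condLExp F P (fun ω => φ (maximiser φ m (a ω))) ω < ∞ := by
    obtain ⟨M, hM⟩ := hφ.exists_forall_map_maximiser_le m
    refine condLExp_lt_top (ne_top_of_le_ne_top (b := ∫⁻ _, (M : ℝ≥0∞) ∂P) ?_
      (lintegral_mono fun ω => hM _))
    rw [lintegral_const]
    exact ENNReal.mul_ne_top ENNReal.coe_ne_top (measure_ne_top _ _)
  choose x hx hx1 hxa using fun m => exists_normalized hF hφ (hX m) (hfin m)
  refine ⟨x, hx, hx1, ?_⟩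
  have hsup := condLExp_iSup (P := P) hF
    (fun m => measurable_conjObjective_comp hφ.mono (hX m) ha)
    fun i j hij ω => monotone_conjObjective_maximiser φ hij (a ω)
  simp only [iSup_conjObjective_maximiser hφ.mono] at hsup
  have hmono : ∀ᵐ ω ∂P, Monotone fun m =>
      condLExp F P (fun ω => conjObjective φ (maximiser φ m (a ω)) (a ω)) ω := by
    have hsucc (m : ℕ) := condLExp_mono (mΩ := F) (P := P)
      (ae_of_all P fun ω => monotone_conjObjective_maximiser φ m.le_succ (a ω))
    filter_upwards [ae_all_iff.2 hsucc] with ω hω using monotone_nat_of_le_succ hω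
  filter_upwards [hsup, hmono,
    ae_all_iff.2 fun m => hxa m ha fun ω => hφ.map_maximiser_add m (a ω)] with ω h1 h2 h3 htop
  obtain ⟨m₀, hm₀⟩ : ∃ m, 1 < condLExp F P
      (fun ω => conjObjective φ (maximiser φ m (a ω)) (a ω)) ω :=
    lt_iSup_iff.1 (by rw [← h1, htop]; exact ENNReal.one_lt_top)
  filter_upwards [eventually_ge_atTop m₀] with m hm using h3 m (hm₀.le.trans (h2 hm))

lemma tsum_two_inv_pow_succ : ∑' k : ℕ, (2⁻¹ : ℝ≥0∞) ^ (k + 1) = 1 := by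
  rw [ENNReal.tsum_geometric_add_one, ENNReal.one_sub_inv_two, inv_inv]
  exact ENNReal.inv_mul_cancel (by simp) (by simp)

lemma exists_seq_ae_eventually_mem [IsFiniteMeasure P] {S : ℕ → ℕ → Set Ω}
    (hS : ∀ k m, MeasurableSet (S k m)) (h : ∀ k, ∀ᵐ ω ∂P, ∀ᶠ m in atTop, ω ∈ S k m) :
    ∃ m : ℕ → ℕ, ∀ᵐ ω ∂P, ∀ᶠ k in atTop, ω ∈ S k (m k) := by
  have hsmall (k : ℕ) : ∃ m, P (S k m)ᶜ ≤ 2⁻¹ ^ (k + 1) := by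
    have hlim : Tendsto (fun m => P (⋃ i ≥ m, (S k i)ᶜ)) atTop (𝓝 0) := by
      have hz : P (⋂ m, ⋃ i ≥ m, (S k i)ᶜ) = 0 := by
        refine measure_eq_zero_iff_ae_notMem.2 ?_
        filter_upwards [h k] with ω hω
        obtain ⟨m, hm⟩ := eventually_atTop.1 hω
        simp only [mem_iInter, mem_iUnion, not_forall]
        exact ⟨m, fun ⟨i, hi, hiS⟩ => hiS (hm i hi)⟩
      rw [← hz]
      exact tendsto_measure_iInter_atTop
        (fun m => (MeasurableSet.biUnion (to_countable _) fun i _ =>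
          (hS k i).compl).nullMeasurableSet)
        (fun m n hmn => biUnion_subset_biUnion_left fun i hi => hmn.trans hi)
        ⟨0, measure_ne_top _ _⟩
    obtain ⟨m, hm⟩ :=
      (hlim.eventually (gt_mem_nhds (ENNReal.pow_pos (a := 2⁻¹) (by simp) (k + 1)))).exists
    exact ⟨m, (measure_mono (subset_biUnion_of_mem (u := fun i => (S k i)ᶜ) le_rfl)).trans hm.le⟩
  choose m hm using hsmall
  refine ⟨m, ?_⟩
  have hsum : ∑' k, P (S k (m k))ᶜ ≠ ∞ :=
    ne_top_of_le_ne_top ENNReal.one_ne_top ((ENNReal.tsum_le_tsum hm).trans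
      tsum_two_inv_pow_succ.le)
  filter_upwards [ae_eventually_notMem hsum] with ω hω using hω.mono fun k hk => not_not.1 hk

lemma IsYoung.exists_mem_orliczSet_forall_le [IsFiniteMeasure P] (hF : F ≤ mΩ) (hφ : IsYoung φ)
    {x : ℕ → Ω → ℝ≥0} (hx : ∀ k, Measurable (x k))
    (hx1 : ∀ k, ∀ᵐ ω ∂P, condLExp F P (fun ω => φ (x k ω)) ω ≤ 1) :
    ∃ z ∈ orliczSet F P φ, ∀ᵐ ω ∂P, ∀ k, 2⁻¹ ^ (k + 1) * x k ω ≤ ‖z ω‖₊ := by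
  set q : ℕ → Ω → ℝ≥0 := fun k ω => 2⁻¹ ^ (k + 1) * x k ω
  have hq (k : ℕ) : Measurable (q k) := measurable_const.mul (hx k)
  have hφq (k : ℕ) : Measurable fun ω => φ (q k ω) := hφ.mono.measurable.comp (hq k)
  have hqle (k : ℕ) : ∀ᵐ ω ∂P, condLExp F P (fun ω => φ (q k ω)) ω ≤ 2⁻¹ ^ (k + 1) := by
    have hmul (ω : Ω) : φ (q k ω) ≤ 2⁻¹ ^ (k + 1) * φ (x k ω) := by
      have h := hφ.map_mul_le (c := 2⁻¹ ^ (k + 1)) (pow_le_one₀ (by positivity) (by norm_num))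
        (x k ω)
      rwa [ENNReal.coe_pow, ENNReal.coe_inv two_ne_zero, ENNReal.coe_ofNat] at h
    filter_upwards [condLExp_mono (mΩ := F) (ae_of_all P hmul), hx1 k,
      condLExp_smul (mΩ := F) (fun ω => φ (x k ω))
        (hφ.mono.measurable.comp (hx k)).aemeasurable (2⁻¹ ^ (k + 1))] with ω h1 h2 h3
    calc condLExp F P (fun ω => φ (q k ω)) ω
        ≤ 2⁻¹ ^ (k + 1) * condLExp F P (fun ω => φ (x k ω)) ω := h1.trans h3.le
      _ ≤ 2⁻¹ ^ (k + 1) := mul_le_of_le_one_right' h2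
  have hint : ∫⁻ ω, ∑' k, φ (q k ω) ∂P ≠ ∞ := by
    have hle : ∫⁻ ω, ∑' k, φ (q k ω) ∂P ≤ ∫⁻ _, 1 ∂P := by
      have hsum : ∑' k, (fun ω => φ (q k ω)) = fun ω => ∑' k, φ (q k ω) :=
        funext fun _ => ENNReal.tsum_apply
      rw [← lintegral_condLExp hF]
      refine lintegral_mono_ae ?_
      filter_upwards [condLExp_tsum (mΩ := F) fun k => (hφq k).aemeasurable,
        ae_all_iff.2 hqle] with ω h1 h2
      rw [← hsum, h1, ENNReal.tsum_apply]
      exact ((ENNReal.tsum_le_tsum h2).trans tsum_two_inv_pow_succ.le)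
    exact ne_top_of_le_ne_top (by simp) hle
  have hfin : ∀ᵐ ω ∂P, ∑' k, φ (q k ω) < ∞ := ae_lt_top (.tsum hφq) hint
  have hsup : Measurable fun ω => ((⨆ k, q k ω : ℝ≥0) : ℝ) :=
    (Measurable.iSup hq).coe_nnreal_real
  refine ⟨AEEqFun.mk _ hsup.aestronglyMeasurable, mem_orliczSet_of_const hF one_pos ?_, ?_⟩
  · refine condLExp_lt_top (ne_top_of_le_ne_top hint (lintegral_mono_ae ?_))
    filter_upwards [AEEqFun.coeFn_mk _ hsup.aestronglyMeasurable (μ := P), hfin] with ω h1 h2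
    rw [h1, NNReal.nnnorm_eq, mul_one]
    exact hφ.map_iSup_le h2
  · filter_upwards [AEEqFun.coeFn_mk _ hsup.aestronglyMeasurable (μ := P), hfin] with ω h1 h2 k
    rw [h1, NNReal.nnnorm_eq]
    exact le_ciSup (hφ.bddAbove_range h2) k

lemma coe_mul_condLExp_le_condLExp_enorm_mul {x : Ω → ℝ≥0} (hx : Measurable x) {z : Ω →ₘ[P] ℝ}
    (y : Ω →ₘ[P] ℝ) {b c : ℝ≥0} (h : ∀ᵐ ω ∂P, c * b * x ω ≤ ‖z ω‖₊) :
    ∀ᵐ ω ∂P, (c : ℝ≥0∞) * condLExp F P (fun ω => ((x ω * (‖y ω‖₊ * b) : ℝ≥0) : ℝ≥0∞)) ω ≤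
      condLExp F P (fun ω => ‖(z * y) ω‖ₑ) ω := by
  have hle : (fun ω => (c : ℝ≥0∞) * ((x ω * (‖y ω‖₊ * b) : ℝ≥0) : ℝ≥0∞)) ≤ᵐ[P]
      fun ω => ‖(z * y) ω‖ₑ := by
    filter_upwards [AEEqFun.coeFn_mul z y, h] with ω h1 h2
    calc (c : ℝ≥0∞) * ((x ω * (‖y ω‖₊ * b) : ℝ≥0) : ℝ≥0∞)
        = ((c * b * x ω * ‖y ω‖₊ : ℝ≥0) : ℝ≥0∞) := by
          rw [← ENNReal.coe_mul]
          congr 1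
          ring
      _ ≤ ‖(z * y) ω‖ₑ := by
          rw [h1, Pi.mul_apply, enorm_eq_nnnorm, nnnorm_mul]
          gcongr
  filter_upwards [condLExp_mono (mΩ := F) hle, condLExp_smul (mΩ := F) (P := P) _
    (hx.mul (y.measurable.nnnorm.mul_const b)).coe_nnreal_ennreal.aemeasurable c] with ω h1 h2
  exact h2.ge.trans h1

lemma ae_exists_condLExp_conj_lt_top [IsFiniteMeasure P] (hF : F ≤ mΩ) (hφ : IsYoung φ)
    {y : Ω →ₘ[P] ℝ} (hy : ∀ x ∈ orliczSet F P φ, x * y ∈ L1F F P) :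
    ∀ᵐ ω ∂P, ∃ k : ℕ, condLExp F P (fun ω => conj φ (‖y ω‖₊ * (4 ^ k)⁻¹)) ω < ∞ := by
  set a : ℕ → Ω → ℝ≥0 := fun k ω => ‖y ω‖₊ * (4 ^ k)⁻¹
  have ha (k : ℕ) : Measurable (a k) := y.measurable.nnnorm.mul measurable_const
  choose x hx hx1 hxa using fun k =>
    exists_seq_eventually_one_le_condLExp_mul (P := P) hF hφ (ha k)
  set β : ℕ → ℕ → Ω → ℝ≥0∞ := fun k m =>
    condLExp F P fun ω => ((x k m ω * a k ω : ℝ≥0) : ℝ≥0∞)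
  obtain ⟨m, hm⟩ := exists_seq_ae_eventually_mem (P := P)
    (S := fun k m => {ω | condLExp F P (fun ω => conj φ (a k ω)) ω = ∞ → 1 ≤ β k m ω})
    (fun k m => (measurable_condLExp' F P _ (measurableSet_singleton ∞)).imp
      (measurable_condLExp' F P _ measurableSet_Ici))
    fun k => (hxa k).mono fun ω h => eventually_imp_distrib_left.2 h
  obtain ⟨z, hz, hzx⟩ := hφ.exists_mem_orliczSet_forall_le hF (fun k => hx k (m k))
    fun k => hx1 k (m k)
  have hlow (k : ℕ) : ∀ᵐ ω ∂P, ((2⁻¹ * 2 ^ k : ℝ≥0) : ℝ≥0∞) * β k (m k) ω ≤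
      condLExp F P (fun ω => ‖(z * y) ω‖ₑ) ω := by
    -- `4 ^ k` beats the loss of `2 ^ (k + 1)` incurred in gluing the `x k (m k)`.
    have hpow : (2⁻¹ : ℝ≥0) * 2 ^ k * (4 ^ k)⁻¹ = 2⁻¹ ^ (k + 1) := by
      rw [show (4 : ℝ≥0) = 2 * 2 by norm_num, mul_pow, pow_succ, inv_pow]
      field_simp
    exact coe_mul_condLExp_le_condLExp_enorm_mul (hx k (m k)) y
      (hzx.mono fun ω h => hpow ▸ h k)
  filter_upwards [hm, ae_all_iff.2 hlow, hy z hz] with ω h1 h2 h3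
  by_contra! htop
  have hlim : Tendsto (fun k : ℕ => ((2⁻¹ * 2 ^ k : ℝ≥0) : ℝ≥0∞)) atTop (𝓝 ∞) :=
    ENNReal.tendsto_coe_nhds_top.2
      ((tendsto_pow_atTop_atTop_of_one_lt one_lt_two).const_mul_atTop (by norm_num))
  have hbig := le_of_tendsto hlim (h1.mono fun k hk =>
    (le_mul_of_one_le_right' (hk (top_le_iff.1 (htop k)))).trans (h2 k))
  exact h3.not_ge hbig

theorem mem_orliczSet_conj [IsFiniteMeasure P] (hF : F ≤ mΩ) (hφ : IsYoung φ)
    {y : Ω →ₘ[P] ℝ} (hy : ∀ x ∈ orliczSet F P φ, x * y ∈ L1F F P) : y ∈ orliczSet F P (conj φ) := by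
  obtain ⟨κ, hκ, hκΦ⟩ := exists_measurable_index fun k =>
    measurable_condLExp F P (fun ω => conj φ (‖y ω‖₊ * (4 ^ k)⁻¹)) (measurableSet_Iio (a := ∞))
  have hlm : Measurable[F] fun ω => (4 : ℝ) ^ κ ω :=
    (measurable_of_countable fun k => (4 : ℝ) ^ k).comp hκ
  have hl := coeFn_toL0F (P := P) hF _ hlm
  refine ⟨toL0F hF _ hlm, ?_, (isPartition_fiber hκ).ae_of_forall fun k => ?_⟩
  · filter_upwards [hl] with ω h
    rw [h]
    positivity
  · have e := condLExp_congr_of_mem (P := P) hF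
      (measurable_comp_div (conj_mono φ) y (toL0F hF _ hlm : L0F F P)).aemeasurable
      ((conj_mono φ).measurable.comp
        (y.measurable.nnnorm.mul_const ((4 ^ k)⁻¹))).aemeasurable (fiber κ hκ k).2 (by
        filter_upwards [hl] with ω h hω
        rw [h, show κ ω = k from hω]
        simp)
    filter_upwards [e, ae_exists_condLExp_conj_lt_top hF hφ hy] with ω h1 h2 hω
    rw [h1 hω]
    have := hκΦ ω (mem_iUnion.2 h2)
    rwa [show κ ω = k from hω] at this

/-! ### Representation of order continuous functionals -/

lemma setInd_inter_mul {A B : Set Ω} (hA : MeasurableSet A) (hB : MeasurableSet B)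
    (x : Ω →ₘ[P] ℝ) : setInd P (A ∩ B) * x = setInd P A * (setInd P B * x) := by
  refine AEEqFun.ext ?_
  filter_upwards [coeFn_setInd_mul (hA.inter hB) x, coeFn_setInd_mul hA (setInd P B * x),
    (coeFn_setInd_mul hB x).indicator (s := A)] with ω h1 h2 h3
  rw [h1, h2, h3, indicator_indicator]

namespace IsDensity

variable {hφ : IsYoung φ} {f : orlicz F P hφ → L0F F P} {x x' : orlicz F P hφ}
  {g g' : Ω →ₘ[P] ℝ}

lemma map_eq (hg : IsDensity f x g) : f x = condE F P g := by
  have hx : restr x univ = x := orlicz_ext <| by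
    simpa only [indicator_univ] using coeFn_restr x MeasurableSet.univ
  have hg_univ : setInd P univ * g = g := AEEqFun.ext <| by
    simpa only [indicator_univ] using coeFn_setInd_mul MeasurableSet.univ g
  simpa only [hx, hg_univ] using hg.map_restr univ MeasurableSet.univ

lemma ae_eq_mul_on [IsFiniteMeasure P] (hF : F ≤ mΩ) (hf : IsLinearMap (L0F F P) f)
    (hg : IsDensity f x g) (hg' : IsDensity f x' g') (a : L0F F P) {B : Set Ω}
    (hB : MeasurableSet B)
    (hx : ∀ᵐ ω ∂P, ω ∈ B → (x : Ω →ₘ[P] ℝ) ω = (a : Ω →ₘ[P] ℝ) ω * (x' : Ω →ₘ[P] ℝ) ω) :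
    ∀ᵐ ω ∂P, ω ∈ B → g ω = (a : Ω →ₘ[P] ℝ) ω * g' ω := by
  have hrestr : ∀ A, MeasurableSet A → restr x (A ∩ B) = a • restr x' (A ∩ B) :=
    fun A hA => orlicz_ext <| by
      filter_upwards [hx, coeFn_restr x (hA.inter hB), coeFn_restr x' (hA.inter hB),
        AEEqFun.coeFn_mul (a : Ω →ₘ[P] ℝ) (restr x' (A ∩ B))] with ω h h1 h2 h3
      rw [h1, Submodule.coe_smul, Subring.smul_def, smul_eq_mul, h3, Pi.mul_apply, h2]
      by_cases hω : ω ∈ A ∩ B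
      · rw [indicator_of_mem hω, indicator_of_mem hω, h hω.2]
      · rw [indicator_of_notMem hω, indicator_of_notMem hω, mul_zero]
  have hB_eq : setInd P B * g = a * (setInd P B * g') :=
    eq_of_forall_condE_setInd_mul_eq hF (setInd_mul_mem_L1F hF hg.mem_L1F B)
      (coe_mul_mem_L1F hF (setInd_mul_mem_L1F hF hg'.mem_L1F B) a) fun A hA => by
      have hAB := hA.inter hB
      rw [mul_left_comm (setInd P A) (a : Ω →ₘ[P] ℝ), ← setInd_inter_mul hA hB,
        ← setInd_inter_mul hA hB, condE_mul hF (setInd_mul_mem_L1F hF hg'.mem_L1F _),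
        ← hg.map_restr _ hAB, ← hg'.map_restr _ hAB, hrestr A hA, hf.map_smul, smul_eq_mul]
  filter_upwards [coeFn_setInd_mul hB g, coeFn_setInd_mul hB g',
    AEEqFun.coeFn_mul (a : Ω →ₘ[P] ℝ) (setInd P B * g')] with ω h1 h2 h3 hω
  rw [hB_eq, h3, Pi.mul_apply, h2, indicator_of_mem hω, indicator_of_mem hω] at h1
  exact h1.symm

end IsDensity

lemma exists_countablyValued_approx (hφ : IsYoung φ) {x : Ω →ₘ[P] ℝ} (hx : x ∈ orlicz F P hφ)
    (hx0 : ∀ᵐ ω ∂P, 0 ≤ x ω) (n : ℕ) :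
    ∃ s : orlicz F P hφ, (∀ᵐ ω ∂P, (n + 1) * |x ω - (s : Ω →ₘ[P] ℝ) ω| ≤ 1) ∧
      ∃ κ : Ω → ℕ, Measurable κ ∧ ∃ c : ℕ → ℝ≥0, ∀ᵐ ω ∂P, (s : Ω →ₘ[P] ℝ) ω = c (κ ω) := by
  have hn : (0 : ℝ) < n + 1 := by positivity
  have hκ : Measurable fun ω => ⌊(n + 1) * x ω⌋₊ :=
    Nat.measurable_floor.comp (x.measurable.const_mul _)
  have hs : Measurable fun ω => (⌊(n + 1) * x ω⌋₊ : ℝ) / (n + 1) :=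
    (measurable_from_nat.comp hκ).div_const _
  have hsx := AEEqFun.coeFn_mk _ (hs.aestronglyMeasurable (μ := P))
  refine ⟨⟨AEEqFun.mk _ hs.aestronglyMeasurable,
    mem_orliczSet_of_abs_le hφ.mono hx ?_⟩, ?_, _, hκ, fun k => k / (n + 1), ?_⟩
  · filter_upwards [hsx, hx0] with ω h h0
    rw [h, abs_of_nonneg (by positivity), abs_of_nonneg h0, div_le_iff₀' hn]
    exact Nat.floor_le (by positivity)
  · filter_upwards [hsx, hx0] with ω h h0
    have hlo := Nat.floor_le (a := (n + 1) * x ω) (by positivity)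
    have hhi := Nat.lt_floor_add_one ((n + 1) * x ω)
    rw [h, ← abs_of_pos hn, ← abs_mul, abs_of_pos hn, mul_sub, mul_div_cancel₀ _ hn.ne', abs_le]
    constructor <;> linarith
  · filter_upwards [hsx] with ω h
    rw [h]
    push_cast
    rfl

section Representation

variable [IsFiniteMeasure P] {hF : F ≤ mΩ} {hφ : IsYoung φ} {f : orlicz F P hφ → L0F F P}
  {y : Ω →ₘ[P] ℝ}

lemma mul_mem_L1F_and_map_eq_of_countablyValued (hf : f ∈ orderDual hF hφ)
    (hy : IsDensity f ⟨1, one_mem_orlicz hF hφ⟩ y) {s : orlicz F P hφ} {κ : Ω → ℕ}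
    (hκ : Measurable κ) {c : ℕ → ℝ≥0} (hs : ∀ᵐ ω ∂P, (s : Ω →ₘ[P] ℝ) ω = c (κ ω)) :
    (s : Ω →ₘ[P] ℝ) * y ∈ L1F F P ∧ f s = muFun F P hφ y s := by
  obtain ⟨g, hg⟩ := exists_density_of_mem_orderDual hf (x := s) (hs.mono fun ω h => by
    rw [h]
    exact (c _).2)
  have hgy : (s : Ω →ₘ[P] ℝ) * y = g := by
    have hlevel : ∀ k, ∀ᵐ ω ∂P, κ ω = k → g ω = c k * y ω := fun k => by
      have hc := coeFn_toL0F (P := P) hF (fun _ => (c k : ℝ)) measurable_const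
      filter_upwards [hc, hg.ae_eq_mul_on hF hf.1.2 hy (toL0F hF (fun _ => (c k : ℝ))
        measurable_const) (hκ (measurableSet_singleton k)) (by
          filter_upwards [hc, hs, AEEqFun.coeFn_one (μ := P) (β := ℝ)] with ω hc hs h1 hω
          rw [hs, hc, h1, Pi.one_apply, mul_one, show κ ω = k from hω])] with ω hc h hω
      rw [h hω, hc]
    refine AEEqFun.ext ?_
    filter_upwards [ae_all_iff.2 hlevel, hs, AEEqFun.coeFn_mul (s : Ω →ₘ[P] ℝ) y] with ω h hs hm
    rw [hm, Pi.mul_apply, hs, h _ rfl]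
  rw [muFun, hgy]
  exact ⟨hg.mem_L1F, hg.map_eq⟩

lemma mul_density_one_mem_L1F (hf : f ∈ orderDual hF hφ)
    (hy : IsDensity f ⟨1, one_mem_orlicz hF hφ⟩ y) {x : Ω →ₘ[P] ℝ} (hx : x ∈ orlicz F P hφ) :
    x * y ∈ L1F F P := by
  have hax := AEEqFun.coeFn_abs x
  obtain ⟨s, hsx, κ, hκ, c, hsc⟩ := exists_countablyValued_approx hφ (x := |x|)
    (mem_orliczSet_of_abs_le hφ.mono hx (hax.mono fun ω h => by rw [h, abs_abs]))
    (hax.mono fun ω h => h ▸ abs_nonneg _) 0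
  have hsy := (mul_mem_L1F_and_map_eq_of_countablyValued hf hy hκ hsc).1
  refine L1F_of_abs_le hF (add_mem_L1F hF (abs_mem_L1F hF hsy) (abs_mem_L1F hF hy.mem_L1F)) ?_
  filter_upwards [hax, hsx, AEEqFun.coeFn_mul x y, AEEqFun.coeFn_mul (s : Ω →ₘ[P] ℝ) y,
    AEEqFun.coeFn_abs ((s : Ω →ₘ[P] ℝ) * y), AEEqFun.coeFn_abs y,
    AEEqFun.coeFn_add |(s : Ω →ₘ[P] ℝ) * y| |y|] with ω h1 h2 h3 h4 h5 h6 h7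
  rw [CharP.cast_eq_zero, zero_add, one_mul, h1] at h2
  have hxs : |x ω| ≤ |(s : Ω →ₘ[P] ℝ) ω| + 1 := by
    linarith [le_abs_self (|x ω| - (s : Ω →ₘ[P] ℝ) ω), le_abs_self ((s : Ω →ₘ[P] ℝ) ω)]
  rw [h3, h7, Pi.mul_apply, Pi.add_apply, h5, h6, h4, Pi.mul_apply, abs_mul, abs_mul,
    abs_of_nonneg (by positivity : 0 ≤ |(s : Ω →ₘ[P] ℝ) ω| * |y ω| + |y ω|)]
  nlinarith [abs_nonneg (y ω)]

lemma exists_bound_map_sub_muFun (hf : f ∈ orderDual hF hφ)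
    (hy : ∀ x ∈ orlicz F P hφ, x * y ∈ L1F F P) : ∃ C : Ω → ℝ, ∀ z : orlicz F P hφ,
      (∀ᵐ ω ∂P, |(z : Ω →ₘ[P] ℝ) ω| ≤ 1) →
      ∀ᵐ ω ∂P, |((f z - muFun F P hφ y z : L0F F P) : Ω →ₘ[P] ℝ) ω| ≤ C ω := by
  have hbounded := fun {g} (hg : g ∈ orderDual hF hφ) =>
    hg.2.1.exists_weight (⟨1, one_mem_orlicz hF hφ⟩ : orlicz F P hφ)
  obtain ⟨w, hw, hwf⟩ := hbounded hf
  obtain ⟨v, hv, hvy⟩ := hbounded (muFun_mem_orderDual hF hφ hy)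
  refine ⟨fun ω => (w ω : ℝ)⁻¹ + (v ω : ℝ)⁻¹, fun z hz => ?_⟩
  have hz1 : ∀ᵐ ω ∂P, |(z : Ω →ₘ[P] ℝ) ω| ≤ |(1 : Ω →ₘ[P] ℝ) ω| := by
    filter_upwards [hz, AEEqFun.coeFn_one (μ := P) (β := ℝ)] with ω h h1
    rwa [h1, Pi.one_apply, abs_one]
  filter_upwards [hwf z hz1, hvy z hz1,
    AEEqFun.coeFn_sub (f z : Ω →ₘ[P] ℝ) (muFun F P hφ y z)] with ω h1 h2 h3
  rw [norm_mul, NNReal.norm_eq, Real.norm_eq_abs] at h1 h2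
  rw [AddSubgroupClass.coe_sub, h3, Pi.sub_apply]
  refine (abs_sub _ _).trans (add_le_add ?_ ?_)
  · rwa [← one_div, le_div_iff₀' (hw.coe_pos ω)]
  · rwa [← one_div, le_div_iff₀' (hv.coe_pos ω)]

lemma exists_forall_nat_mul_abs_map_sub_muFun_le (hf : f ∈ orderDual hF hφ)
    (hy : IsDensity f ⟨1, one_mem_orlicz hF hφ⟩ y) {x : orlicz F P hφ}
    (hx : ∀ᵐ ω ∂P, 0 ≤ (x : Ω →ₘ[P] ℝ) ω) : ∃ C : Ω → ℝ, ∀ n : ℕ, ∀ᵐ ω ∂P,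
      (n + 1) * |((f x - muFun F P hφ y x : L0F F P) : Ω →ₘ[P] ℝ) ω| ≤ C ω := by
  have hmul := fun x hx => mul_density_one_mem_L1F hf hy (x := x) hx
  have hμ := isLinearMap_muFun hF hφ hmul
  obtain ⟨C, hC⟩ := exists_bound_map_sub_muFun hf hmul
  refine ⟨C, fun n => ?_⟩
  obtain ⟨s, hsx, κ, hκ, c, hsc⟩ := exists_countablyValued_approx hφ x.2 hx n
  have hs := (mul_mem_L1F_and_map_eq_of_countablyValued hf hy hκ hsc).2
  set a : L0F F P := toL0F hF (fun _ => (n + 1 : ℝ)) measurable_const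
  have ha : (a : Ω →ₘ[P] ℝ) =ᵐ[P] fun _ => (n + 1 : ℝ) := coeFn_toL0F hF _ measurable_const
  have hdiff : f (a • (x - s)) - muFun F P hφ y (a • (x - s)) =
      a * (f x - muFun F P hφ y x) := by
    rw [hf.1.2.map_smul, hμ.map_smul, hf.1.2.map_sub, hμ.map_sub, hs, smul_eq_mul, smul_eq_mul]
    ring
  filter_upwards [ha, AEEqFun.coeFn_mul (a : Ω →ₘ[P] ℝ) (f x - muFun F P hφ y x : L0F F P),
    hC (a • (x - s)) (by
      filter_upwards [ha, hsx, AEEqFun.coeFn_mul (a : Ω →ₘ[P] ℝ) (x - s : orlicz F P hφ),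
        AEEqFun.coeFn_sub (x : Ω →ₘ[P] ℝ) s] with ω h1 h2 h3 h4
      rwa [Submodule.coe_smul, Subring.smul_def, smul_eq_mul, h3, Pi.mul_apply, h1,
        AddSubgroupClass.coe_sub, h4, Pi.sub_apply, abs_mul,
        abs_of_nonneg (by positivity : (0 : ℝ) ≤ n + 1)])] with ω h1 h2 h3
  rwa [hdiff, Subring.coe_mul, h2, Pi.mul_apply, h1, abs_mul,
    abs_of_nonneg (by positivity : (0 : ℝ) ≤ n + 1)] at h3

lemma map_eq_muFun_of_nonneg (hf : f ∈ orderDual hF hφ)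
    (hy : IsDensity f ⟨1, one_mem_orlicz hF hφ⟩ y) {x : orlicz F P hφ}
    (hx : ∀ᵐ ω ∂P, 0 ≤ (x : Ω →ₘ[P] ℝ) ω) : f x = muFun F P hφ y x := by
  obtain ⟨C, hC⟩ := exists_forall_nat_mul_abs_map_sub_muFun_le hf hy hx
  refine sub_eq_zero.1 (L0F_ext ?_)
  filter_upwards [ae_all_iff.2 hC, AEEqFun.coeFn_zero (μ := P) (β := ℝ)] with ω h h0
  rw [Subring.coe_zero, h0, Pi.zero_apply]
  by_contra hne
  obtain ⟨n, hn⟩ := exists_nat_gt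
    (C ω / |((f x - muFun F P hφ y x : L0F F P) : Ω →ₘ[P] ℝ) ω|)
  rw [div_lt_iff₀ (abs_pos.2 hne)] at hn
  linarith [h n, abs_nonneg (((f x - muFun F P hφ y x : L0F F P) : Ω →ₘ[P] ℝ) ω)]

lemma eq_muFun_of_isDensity_one (hf : f ∈ orderDual hF hφ)
    (hy : IsDensity f ⟨1, one_mem_orlicz hF hφ⟩ y) : f = muFun F P hφ y := by
  have hμ := isLinearMap_muFun hF hφ fun x hx => mul_density_one_mem_L1F hf hy (x := x) hx
  ext1 x
  have hax := AEEqFun.coeFn_abs (x : Ω →ₘ[P] ℝ)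
  let p : orlicz F P hφ := ⟨|(x : Ω →ₘ[P] ℝ)|,
    mem_orliczSet_of_abs_le hφ.mono x.2 (hax.mono fun ω h => by rw [h, abs_abs])⟩
  have hp := map_eq_muFun_of_nonneg hf hy (x := p) (hax.mono fun ω h => h ▸ abs_nonneg _)
  have hpx := map_eq_muFun_of_nonneg hf hy (x := p - x) <| by
    filter_upwards [hax, AEEqFun.coeFn_sub |(x : Ω →ₘ[P] ℝ)| x] with ω h1 h2
    rw [AddSubgroupClass.coe_sub, h2, Pi.sub_apply, h1]
    exact sub_nonneg.2 (le_abs_self _)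
  rwa [hf.1.2.map_sub, hμ.map_sub, hp, sub_right_inj] at hpx

theorem orderDual_subset_image (hF : F ≤ mΩ) (hφ : IsYoung φ) :
    orderDual hF hφ ⊆ muFun F P hφ '' orliczSet F P (conj φ) := fun f hf => by
  obtain ⟨y, hy⟩ := exists_density_of_mem_orderDual hf (x := ⟨1, one_mem_orlicz hF hφ⟩) <| by
    filter_upwards [AEEqFun.coeFn_one (μ := P) (β := ℝ)] with ω h
    rw [h]
    exact zero_le_one
  exact ⟨y, mem_orliczSet_conj hF hφ fun x hx => mul_density_one_mem_L1F hf hy hx,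
    (eq_muFun_of_isDensity_one hf hy).symm⟩

end Representation

end CondOrlicz

end

open CondOrlicz in
theorem proposition4p8 {Ω : Type*} (F : MeasurableSpace Ω) [mΩ : MeasurableSpace Ω]
    (hF : F ≤ mΩ) (P : MeasureTheory.Measure Ω) [MeasureTheory.IsProbabilityMeasure P]
    (φ : NNReal → ENNReal) (hφ : IsYoung φ) :
    -- every `μ_y` is well defined: `x y ∈ L¹_F` for `x ∈ L^φ_F`, `y ∈ L^{φ*}_F`
    (∀ x ∈ orlicz F P hφ, ∀ y ∈ orliczSet F P (conj φ), x * y ∈ L1F F P) ∧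
    -- the conditionally order continuous functionals are exactly the `μ_y`
    orderDual hF hφ = muFun F P hφ '' orliczSet F P (conj φ) ∧
    -- the same as an equality of conditional sets
    condSet P hF (orderDual hF hφ) = condBuilder P hF (muFun F P hφ '' orliczSet F P (conj φ)) ∧
    -- `y` is determined by `μ_y`
    Set.InjOn (muFun F P hφ) (orliczSet F P (conj φ)) := by
  have heq : orderDual hF hφ = muFun F P hφ '' orliczSet F P (conj φ) := by
    refine Subset.antisymm (orderDual_subset_image hF hφ) ?_
    rintro _ ⟨y, hy, rfl⟩
    exact muFun_mem_orderDual hF hφ fun x hx => mul_mem_L1F hF hφ hx hy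
  refine ⟨fun x hx y hy => mul_mem_L1F hF hφ hx hy, heq, ?_, injOn_muFun hF hφ⟩
  rw [condBuilder, ccHull_image_muFun hF hφ, heq]
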